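/- For a prime $q$, let $B_q$ be the set of complete flags in $\mathbb F_q^3$, i.e. of pairs $(V_1,V_2)$ of subspaces $V_1\subset V_2\subset\mathbb F_q^3$ with $\dim V_1=1$ and $\dim V_2=2$, and let $\Phi_q\colon \mathrm{SL}_3(\mathbb Z)\to\mathrm{Sym}(B_q)$ be the action $\Phi_q(\gamma)(V_1,V_2)=(\bar\gamma V_1,\bar\gamma V_2)$, where $\bar\gamma\in\mathrm{SL}_3(\mathbb F_q)$ is the reduction of $\gamma$ modulo $q$. For a matrix $A=(a_{ij})$ write $\|A\|_\infty=\max_{i,j}|a_{ij}|$. There is a constant $C>0$ such that for every $\epsilon>0$ there is a constant $K_\epsilon>0$, depending only on $\epsilon$, such that for every prime $q$ and every real $T$ with $0\le T\le Cq^3$, the set $$\{(\gamma,x)\in \mathrm{SL}_3(\mathbb Z)\times B_q : \|\gamma\|_\infty\,\|\gamma^{-1}\|_\infty\le T,\ \Phi_q(\gamma)(x)=x\}$$ is finite and has at most $K_\epsilon\, q^{3+\epsilon}\,T$ elements. -/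

import Mathlib

open scoped MatrixGroups

section EntryNorm

attribute [local instance] Matrix.normedAddCommGroup

/-- The maximum of the absolute values of the entries of an integer `3 × 3` matrix. -/
noncomputable def entryNorm (A : Matrix (Fin 3) (Fin 3) ℤ) : ℝ := ‖A‖

theorem entryNorm_le_iff (A : Matrix (Fin 3) (Fin 3) ℤ) {r : ℝ} (hr : 0 ≤ r) :
    entryNorm A ≤ r ↔ ∀ i j, |(A i j : ℝ)| ≤ r := by
  simp [entryNorm, Matrix.norm_le_iff hr, Int.norm_eq_abs]

end EntryNorm

/-- A complete flag in `K³`: subspaces `V₁ ⊆ V₂` of `K³` of dimensions `1` and `2`. -/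
@[ext]
structure CompleteFlag (K : Type*) [Field K] where
  V₁ : Submodule K (Fin 3 → K)
  V₂ : Submodule K (Fin 3 → K)
  finrank_V₁ : Module.finrank K V₁ = 1
  finrank_V₂ : Module.finrank K V₂ = 2
  le : V₁ ≤ V₂

namespace CompleteFlag

variable {K : Type*} [Field K]

/-- The image `(g V₁, g V₂)` of a flag `(V₁, V₂)` under a linear automorphism `g` of `K³`. -/
def map (g : (Fin 3 → K) ≃ₗ[K] (Fin 3 → K)) (x : CompleteFlag K) : CompleteFlag K where
  V₁ := x.V₁.map (g : (Fin 3 → K) →ₗ[K] (Fin 3 → K))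
  V₂ := x.V₂.map (g : (Fin 3 → K) →ₗ[K] (Fin 3 → K))
  finrank_V₁ := (LinearEquiv.finrank_map_eq g x.V₁).trans x.finrank_V₁
  finrank_V₂ := (LinearEquiv.finrank_map_eq g x.V₂).trans x.finrank_V₂
  le := Submodule.map_mono x.le

theorem map_one (x : CompleteFlag K) : map 1 x = x := by
  ext v <;> simp [map]

theorem map_mul (g h : (Fin 3 → K) ≃ₗ[K] (Fin 3 → K)) (x : CompleteFlag K) :
    map (g * h) x = map g (map h x) :=
  CompleteFlag.ext (Submodule.map_comp (h : (Fin 3 → K) →ₗ[K] (Fin 3 → K)) _ x.V₁)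
    (Submodule.map_comp (h : (Fin 3 → K) →ₗ[K] (Fin 3 → K)) _ x.V₂)

/-- The action of the linear automorphisms of `K³` on complete flags. -/
def permHom : ((Fin 3 → K) ≃ₗ[K] (Fin 3 → K)) →* Equiv.Perm (CompleteFlag K) where
  toFun g :=
    { toFun := map g
      invFun := map g⁻¹
      left_inv := fun x => by rw [← map_mul, inv_mul_cancel, map_one]
      right_inv := fun x => by rw [← map_mul, mul_inv_cancel, map_one] }
  map_one' := Equiv.ext map_one
  map_mul' g h := Equiv.ext (map_mul g h)

end CompleteFlag

/-- The action of `SL₃(ℤ)` on the complete flags of `𝔽_q³`, through reduction modulo `q`. -/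
def flagAction (q : ℕ) [Fact q.Prime] :
    SL(3, ℤ) →* Equiv.Perm (CompleteFlag (ZMod q)) :=
  (CompleteFlag.permHom.comp Matrix.SpecialLinearGroup.toLin').comp
    (Matrix.SpecialLinearGroup.map (Int.castRingHom (ZMod q)))

/-- The pairs `(γ, x)` with `‖γ‖_∞ ‖γ⁻¹‖_∞ ≤ T` and `γ` fixing the flag `x` modulo `q`. -/
def fixedFlagPairs (q : ℕ) [Fact q.Prime] (T : ℝ) :
    Set (SL(3, ℤ) × CompleteFlag (ZMod q)) :=
  {p | entryNorm (p.1 : Matrix (Fin 3) (Fin 3) ℤ) *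
        entryNorm ((p.1⁻¹ : SL(3, ℤ)) : Matrix (Fin 3) (Fin 3) ℤ) ≤ T ∧
      flagAction q p.1 p.2 = p.2}

/-! ### Eigenvectors and incident eigencovectors over a finite field -/

section FixedFlags

open Matrix Finset

variable {K : Type*} [Field K]

/-! Few flags are fixed unless γ is special modulo q. A flag is a line spanned by v and a plane cut
out by a covector w with w·v = 0, and it is fixed when v and w are eigenvectors. So γ fixes O(q^3)
flags in general, O(q) if it is not scalar modulo q, and O(1) if γ - c has rank at least 2 for every
c. Off the diagonal adj(γ - c) = adj γ + cγ, so this rank condition can fail only if γ satisfies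
`OffDiagProportional`.

Put N = ⌊T⌋ ≤ q^3. Up to powers of log q there are at most N^2 elements in the ball, N q^2
proportional ones and N scalar ones. The contributions N^2, q·N q^2 and q^3·N are all at most q^3 N,
and the logarithms cost q^ε.

For the counts, inversion reduces to ‖γ‖ ≤ ‖γ⁻¹‖. Localise ‖γ⁻¹‖ dyadically at S, with ‖γ‖ ≤ R, and
shift indices so that the largest entry of γ⁻¹ is in the last column. Let p and s be the upper two
entries of the last columns of γ and γ⁻¹, and g the gcd of p. Since s consists of minors involving
p, g divides s, leaving O((S/g)^2) values of s. Given p and s, each of the other two upper columns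
lies on a line of direction p, with O(Rg/|p|) points. The third row then has O(1) choices. The
powers of g cancel and the sum of |p|^-2 is logarithmic, giving (RS)^2. If γ is a given scalar
modulo q, both p and the steps along the lines are divisible by q, which saves q^4. If γ is
proportional, q divides det(p, s), which saves q/g, and the sum of g/|p|^2 is still logarithmic. -/

theorem exists_minor_ne_zero {N : Matrix (Fin 3) (Fin 3) K} {i j : Fin 3}
    (h : N.adjugate i j ≠ 0) : ∃ a b k l, N a k * N b l ≠ N a l * N b k := by
  by_contra! H
  apply h
  rw [adjugate_fin_three]
  fin_cases i <;> fin_cases j <;> simp <;> grind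

variable [DecidableEq K]

/-- The roots of the characteristic polynomial. -/
noncomputable def eigenvalueFinset (g : Matrix (Fin 3) (Fin 3) K) : Finset K :=
  g.charpoly.roots.toFinset

theorem card_eigenvalueFinset_le (g : Matrix (Fin 3) (Fin 3) K) : #(eigenvalueFinset g) ≤ 3 := by
  refine (Multiset.toFinset_card_le _).trans ((Polynomial.card_roots' _).trans ?_)
  simp

theorem mem_eigenvalueFinset {g : Matrix (Fin 3) (Fin 3) K} {c : K}
    (h : (g - scalar (Fin 3) c).det = 0) : c ∈ eigenvalueFinset g := by
  rw [eigenvalueFinset, Multiset.mem_toFinset, Polynomial.mem_roots (charpoly_monic g).ne_zero,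
    Polynomial.IsRoot, eval_charpoly, ← neg_sub, det_neg, h, mul_zero]

variable [Fintype K]

theorem card_parallel_le {z : Fin 3 → K} (hz : z ≠ 0) :
    #{v : Fin 3 → K | ∀ a b, v a * z b = v b * z a} ≤ Fintype.card K := by
  obtain ⟨i, hi⟩ := Function.ne_iff.1 hz
  refine Finset.card_le_card_of_injOn (t := Finset.univ) (fun v => v i) (by simp) ?_
  intro v hv v' hv' h
  simp only [coe_filter, mem_univ, true_and, Set.mem_ofPred_eq] at hv hv' h
  ext a
  have h1 := hv a i
  have h2 := hv' a i
  rw [h, ← h2] at h1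
  exact mul_right_cancel₀ hi h1

theorem card_orthogonal_le {y : Fin 3 → K} (hy : y ≠ 0) :
    #{v : Fin 3 → K | y ⬝ᵥ v = 0} ≤ Fintype.card K ^ 2 := by
  obtain ⟨i, hi⟩ := Function.ne_iff.1 hy
  rw [sq, ← Fintype.card_prod]
  refine Finset.card_le_card_of_injOn (t := Finset.univ) (fun v => (v (i + 1), v (i + 2)))
    (by simp) ?_
  intro v hv v' hv' h
  simp only [coe_filter, mem_univ, true_and, Set.mem_ofPred_eq, Prod.mk.injEq] at hv hv' h
  obtain ⟨h1, h2⟩ := h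
  have key : y i * v i = y i * v' i := by
    have := hv.trans hv'.symm
    rw [dotProduct, dotProduct, ← Equiv.sum_comp (Equiv.addLeft i),
      ← Equiv.sum_comp (Equiv.addLeft i) (fun k => y k * v' k)] at this
    simpa [Fin.sum_univ_three, h1, h2] using this
  have h0 := mul_left_cancel₀ hi key
  ext a
  obtain rfl | rfl | rfl : a = i ∨ a = i + 1 ∨ a = i + 2 := by
    clear * -
    decide +revert
  exacts [h0, h1, h2]

theorem card_orthogonal_pair_le {y y' : Fin 3 → K} (h : ∃ a b, y a * y' b ≠ y b * y' a) :
    #{v : Fin 3 → K | y ⬝ᵥ v = 0 ∧ y' ⬝ᵥ v = 0} ≤ Fintype.card K := by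
  have hz : ![y 1 * y' 2 - y 2 * y' 1, y 2 * y' 0 - y 0 * y' 2, y 0 * y' 1 - y 1 * y' 0] ≠ 0 := by
    intro h0
    have e0 := sub_eq_zero.1 (congrFun h0 0)
    have e1 := sub_eq_zero.1 (congrFun h0 1)
    have e2 := sub_eq_zero.1 (congrFun h0 2)
    obtain ⟨a, b, hab⟩ := h
    apply hab
    fin_cases a <;> fin_cases b <;>
      first
      | rfl
      | assumption
      | (symm; assumption)
  refine (card_le_card ?_).trans (card_parallel_le hz)
  intro v hv
  simp only [mem_filter, mem_univ, true_and, dotProduct, Fin.sum_univ_three] at hv ⊢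
  obtain ⟨h1, h2⟩ := hv
  have e01 : v 0 * (y 2 * y' 0 - y 0 * y' 2) = v 1 * (y 1 * y' 2 - y 2 * y' 1) := by
    linear_combination y 2 * h2 - y' 2 * h1
  have e12 : v 1 * (y 0 * y' 1 - y 1 * y' 0) = v 2 * (y 2 * y' 0 - y 0 * y' 2) := by
    linear_combination y 0 * h2 - y' 0 * h1
  have e20 : v 2 * (y 1 * y' 2 - y 2 * y' 1) = v 0 * (y 0 * y' 1 - y 1 * y' 0) := by
    linear_combination y 1 * h2 - y' 1 * h1
  intro a b
  fin_cases a <;> fin_cases b <;>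
    first
    | rfl
    | assumption
    | (symm; assumption)

/-- Incident pairs of nonzero vectors and covectors, both eigenvectors of `g`. -/
def incidentEigenpairs (g : Matrix (Fin 3) (Fin 3) K) : Finset ((Fin 3 → K) × (Fin 3 → K)) :=
  open Classical in
  {p | p.1 ≠ 0 ∧ p.2 ≠ 0 ∧ p.2 ⬝ᵥ p.1 = 0 ∧ (∃ c : K, g *ᵥ p.1 = c • p.1) ∧
    ∃ c : K, p.2 ᵥ* g = c • p.2}

theorem card_incidentEigenpairs_le (g : Matrix (Fin 3) (Fin 3) K) :
    #(incidentEigenpairs g) ≤ Fintype.card K ^ 5 := by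
  have h : incidentEigenpairs g ⊆ ({v : Fin 3 → K | v ≠ 0} : Finset _).biUnion
      fun v => ({w : Fin 3 → K | v ⬝ᵥ w = 0} : Finset _).image fun w => (v, w) := by
    rintro ⟨v, w⟩ hp
    simp only [incidentEigenpairs, mem_filter, mem_univ, true_and] at hp
    simp only [mem_biUnion, mem_filter, mem_univ, true_and, mem_image]
    exact ⟨v, hp.1, w, by rw [dotProduct_comm]; exact hp.2.2.1, rfl⟩
  refine (card_le_card h).trans ((card_biUnion_le_card_mul _ _ (Fintype.card K ^ 2) ?_).trans ?_)
  · intro v hv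
    exact card_image_le.trans (card_orthogonal_le (by simpa using hv))
  · rw [show (5 : ℕ) = 3 + 2 from rfl, pow_add]
    gcongr
    refine (card_le_univ _).trans ?_
    simp

/-- The vector and the covector may have different eigenvalues, each one of at most three roots of
the characteristic polynomial: hence the 9. -/
theorem card_incidentEigenpairs_le_of_forall {g : Matrix (Fin 3) (Fin 3) K} {n : ℕ}
    (h : ∀ c d : K, #{p : (Fin 3 → K) × (Fin 3 → K) | p.2 ⬝ᵥ p.1 = 0 ∧
      (g - scalar (Fin 3) c) *ᵥ p.1 = 0 ∧ p.2 ᵥ* (g - scalar (Fin 3) d) = 0} ≤ n) :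
    #(incidentEigenpairs g) ≤ 9 * n := by
  have hsub : incidentEigenpairs g ⊆ (eigenvalueFinset g ×ˢ eigenvalueFinset g).biUnion
      fun c => {p : (Fin 3 → K) × (Fin 3 → K) | p.2 ⬝ᵥ p.1 = 0 ∧
      (g - scalar (Fin 3) c.1) *ᵥ p.1 = 0 ∧ p.2 ᵥ* (g - scalar (Fin 3) c.2) = 0} := by
    rintro ⟨v, w⟩ hp
    simp only [incidentEigenpairs, mem_filter, mem_univ, true_and] at hp
    obtain ⟨hv, hw, hvw, ⟨c, hc⟩, d, hd⟩ := hp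
    have h1 : (g - scalar (Fin 3) c) *ᵥ v = 0 := by
      rw [sub_mulVec, hc, scalar_apply, ← smul_one_eq_diagonal, smul_mulVec, one_mulVec, sub_self]
    have h2 : w ᵥ* (g - scalar (Fin 3) d) = 0 := by
      rw [vecMul_sub, hd, scalar_apply, ← smul_one_eq_diagonal, vecMul_smul, vecMul_one, sub_self]
    simp only [mem_biUnion, mem_product, mem_filter, mem_univ, true_and]
    exact ⟨(c, d), ⟨mem_eigenvalueFinset (exists_mulVec_eq_zero_iff.1 ⟨v, hv, h1⟩),
      mem_eigenvalueFinset (exists_vecMul_eq_zero_iff.1 ⟨w, hw, h2⟩)⟩, hvw, h1, h2⟩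
  refine (card_le_card hsub).trans
    ((card_biUnion_le_card_mul _ _ n fun c _ => h c.1 c.2).trans ?_)
  rw [card_product]
  gcongr
  have := card_eigenvalueFinset_le g
  nlinarith

/-- If v is parallel to x, there are q choices of v and q^2 of w in the plane orthogonal to x.
Otherwise v has q^2 choices and w satisfies two independent equations. -/
theorem card_incident_le {y x : Fin 3 → K} (hy : y ≠ 0) (hx : x ≠ 0) :
    #{p : (Fin 3 → K) × (Fin 3 → K) | p.2 ⬝ᵥ p.1 = 0 ∧ y ⬝ᵥ p.1 = 0 ∧ p.2 ⬝ᵥ x = 0} ≤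
      2 * Fintype.card K ^ 3 := by
  have hsub : ({p : (Fin 3 → K) × (Fin 3 → K) | p.2 ⬝ᵥ p.1 = 0 ∧ y ⬝ᵥ p.1 = 0 ∧ p.2 ⬝ᵥ x = 0} :
      Finset _) ⊆ ({v : Fin 3 → K | ∀ a b, v a * x b = v b * x a} : Finset _) ×ˢ
        ({w : Fin 3 → K | x ⬝ᵥ w = 0} : Finset _) ∪
      ({v : Fin 3 → K | y ⬝ᵥ v = 0 ∧ ∃ a b, v a * x b ≠ v b * x a} : Finset _).biUnion fun v =>
        ({w : Fin 3 → K | v ⬝ᵥ w = 0 ∧ x ⬝ᵥ w = 0} : Finset _).image fun w => (v, w) := by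
    rintro ⟨v, w⟩ hp
    simp only [mem_filter, mem_univ, true_and, mem_union, mem_product, mem_biUnion,
      mem_image] at hp ⊢
    obtain ⟨h1, h2, h3⟩ := hp
    rw [dotProduct_comm] at h1 h3
    by_cases h : ∀ a b, v a * x b = v b * x a
    · exact Or.inl ⟨h, h3⟩
    · push Not at h
      exact Or.inr ⟨v, ⟨h2, h⟩, w, ⟨h1, h3⟩, rfl⟩
  refine (card_le_card hsub).trans ((card_union_le _ _).trans ?_)
  rw [two_mul]
  gcongr
  · rw [card_product, pow_succ']
    gcongr
    exacts [card_parallel_le hx, card_orthogonal_le hx]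
  · refine (card_biUnion_le_card_mul _ _ (Fintype.card K) ?_).trans ?_
    · intro v hv
      simp only [mem_filter, mem_univ, true_and] at hv
      exact card_image_le.trans (card_orthogonal_pair_le hv.2)
    · rw [pow_succ]
      gcongr
      refine (card_le_card ?_).trans (card_orthogonal_le hy)
      intro v hv
      simp only [mem_filter, mem_univ, true_and] at hv ⊢
      exact hv.1

/-- A nonzero row of `g - c` and a nonzero column of `g - d` leave one linear condition on each of v
and w, besides incidence. -/
theorem card_incidentEigenpairs_le_of_not_scalar {g : Matrix (Fin 3) (Fin 3) K}
    (hg : ∀ c, g ≠ scalar (Fin 3) c) :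
    #(incidentEigenpairs g) ≤ 9 * (2 * Fintype.card K ^ 3) := by
  refine card_incidentEigenpairs_le_of_forall fun c d => ?_
  have hc : ∃ i, (g - scalar (Fin 3) c) i ≠ 0 := Function.ne_iff.1 (sub_ne_zero.2 (hg c))
  have hd : ∃ i, (g - scalar (Fin 3) d)ᵀ i ≠ 0 := by
    refine Function.ne_iff.1 (fun h => hg d (sub_eq_zero.1 ?_))
    exact transpose_eq_zero.1 h
  obtain ⟨i, hi⟩ := hc
  obtain ⟨j, hj⟩ := hd
  refine (card_le_card ?_).trans (card_incident_le hi hj)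
  intro p hp
  simp only [mem_filter, mem_univ, true_and] at hp ⊢
  exact ⟨hp.1, congrFun hp.2.1 i, congrFun hp.2.2 j⟩

/-- If `g - c` had rank at most 1, its adjugate would vanish, making adj g equal to -c g off the
diagonal, against `hg`. So all left and right eigenspaces are at most lines, and incidence is not
needed. -/
theorem card_incidentEigenpairs_le_of_adjugate {g : Matrix (Fin 3) (Fin 3) K} {i k j : Fin 3}
    (hi : i ≠ j) (hk : k ≠ j) (hg : g i j * g.adjugate k j ≠ g k j * g.adjugate i j) :
    #(incidentEigenpairs g) ≤ 9 * Fintype.card K ^ 2 := by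
  have adj : ∀ (c : K) (i j : Fin 3), i ≠ j →
      g.adjugate i j = (g - scalar (Fin 3) c).adjugate i j - c * g i j := by
    intro c i j hij
    rw [adjugate_fin_three, adjugate_fin_three]
    fin_cases i <;> fin_cases j <;> simp at hij ⊢ <;> ring
  have minor : ∀ c : K, ∃ a b k l, (g - scalar (Fin 3) c) a k * (g - scalar (Fin 3) c) b l ≠
      (g - scalar (Fin 3) c) a l * (g - scalar (Fin 3) c) b k := by
    intro c
    by_cases h1 : (g - scalar (Fin 3) c).adjugate k j = 0
    · refine exists_minor_ne_zero (i := i) (j := j) fun h2 => hg ?_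
      rw [adj c k j hk, adj c i j hi, h1, h2]
      ring
    · exact exists_minor_ne_zero h1
  refine card_incidentEigenpairs_le_of_forall fun c d => ?_
  obtain ⟨a, b, k, l, hc⟩ := minor c
  obtain ⟨a', b', k', l', hd⟩ := minor d
  refine (card_le_card (t := ({v : Fin 3 → K | (g - scalar (Fin 3) c) a ⬝ᵥ v = 0 ∧
      (g - scalar (Fin 3) c) b ⬝ᵥ v = 0} : Finset _) ×ˢ
    ({v : Fin 3 → K | (g - scalar (Fin 3) d)ᵀ k' ⬝ᵥ v = 0 ∧
      (g - scalar (Fin 3) d)ᵀ l' ⬝ᵥ v = 0} : Finset _)) ?_).trans ?_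
  · rintro ⟨v, w⟩ hp
    simp only [mem_filter, mem_univ, true_and, mem_product] at hp ⊢
    refine ⟨⟨congrFun hp.2.1 a, congrFun hp.2.1 b⟩, ?_, ?_⟩ <;> rw [dotProduct_comm]
    exacts [congrFun hp.2.2 k', congrFun hp.2.2 l']
  · rw [card_product, sq]
    gcongr
    · exact card_orthogonal_pair_le ⟨k, l, hc⟩
    · refine card_orthogonal_pair_le ⟨a', b', ?_⟩
      simp only [transpose_apply]
      intro h
      exact hd (by rw [h, mul_comm])

end FixedFlags

/-! ### From fixed flags to eigenpairs -/

section FlagRepresentatives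

open Matrix Finset

variable {K : Type*} [Field K]

theorem CompleteFlag.exists_vector (x : CompleteFlag K) :
    ∃ v : Fin 3 → K, v ≠ 0 ∧ x.V₁ = Submodule.span K {v} := by
  obtain ⟨v, hv, h⟩ := finrank_eq_one_iff'.1 x.finrank_V₁
  refine ⟨v, by simpa using hv, le_antisymm (fun u hu => ?_) ?_⟩
  · obtain ⟨c, hc⟩ := h ⟨u, hu⟩
    exact Submodule.mem_span_singleton.2 ⟨c, congrArg Subtype.val hc⟩
  · simp

theorem CompleteFlag.exists_covector (x : CompleteFlag K) :
    ∃ w : Fin 3 → K, w ≠ 0 ∧ ∀ u, u ∈ x.V₂ ↔ w ⬝ᵥ u = 0 := by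
  have hlt : x.V₂ < ⊤ := by
    rw [lt_top_iff_ne_top]
    intro h
    have := x.finrank_V₂
    rw [h, finrank_top] at this
    simp at this
  obtain ⟨f, hf, hle⟩ := Submodule.exists_le_ker_of_lt_top _ hlt
  have hker : x.V₂ = LinearMap.ker f := by
    refine Submodule.eq_of_le_of_finrank_eq hle ?_
    have := Module.Dual.finrank_ker_add_one_of_ne_zero (f := f) hf
    rw [x.finrank_V₂]
    simp at this
    omega
  have hdot : ∀ u, f u = (fun i => f (Pi.single i 1)) ⬝ᵥ u := by
    intro u
    conv_lhs => rw [← Finset.univ_sum_single u, map_sum]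
    refine Finset.sum_congr rfl fun i _ => ?_
    rw [mul_comm, ← smul_eq_mul, ← map_smul, ← Pi.single_smul, smul_eq_mul, mul_one]
  refine ⟨fun i => f (Pi.single i 1), fun h => hf ?_, fun u => ?_⟩
  · ext u
    simpa using congrFun h u
  · rw [hker, LinearMap.mem_ker, hdot]

theorem exists_smul_eq_of_orthogonal_le {w w' : Fin 3 → K}
    (h : ∀ u, w ⬝ᵥ u = 0 → w' ⬝ᵥ u = 0) : ∃ c : K, w' = c • w := by
  by_cases hw : w = 0
  · refine ⟨0, ?_⟩
    ext i
    have := h (Pi.single i 1) (by simp [hw])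
    simpa using this
  · obtain ⟨i, hi⟩ := Function.ne_iff.1 hw
    simp only [Pi.zero_apply] at hi
    refine ⟨w' i / w i, ?_⟩
    ext a
    -- This test vector is orthogonal to w, and together with `hi` it forces w' to be proportional
    -- to w.
    have := h (Pi.single a (w i) - Pi.single i (w a)) (by simp [dotProduct_sub]; ring)
    simp only [dotProduct_sub, dotProduct_single] at this
    simp only [Pi.smul_apply, smul_eq_mul]
    field_simp
    linear_combination this

variable [Fintype K] [DecidableEq K]

instance : Finite (CompleteFlag K) :=
  Finite.of_injective (fun x : CompleteFlag K => (x.V₁, x.V₂)) fun x y h => by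
    simp only [Prod.mk.injEq] at h
    exact CompleteFlag.ext h.1 h.2

/-- Scaling v and w independently turns each fixed flag into (q - 1)^2 eigenpairs, and the flag can
be recovered from any of them. -/
theorem ncard_fixed_mul_le (g : Matrix (Fin 3) (Fin 3) K)
    (e : (Fin 3 → K) ≃ₗ[K] (Fin 3 → K)) (he : ∀ v, e v = g *ᵥ v) :
    {x : CompleteFlag K | x.map e = x}.ncard * (Fintype.card K - 1) ^ 2 ≤
      #(incidentEigenpairs g) := by
  choose v hv hv1 using fun x : CompleteFlag K => x.exists_vector
  choose w hw hw2 using fun x : CompleteFlag K => x.exists_covector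
  have hmem : ∀ x : CompleteFlag K, x.map e = x → ∀ s t : Kˣ,
      ((s : K) • v x, (t : K) • w x) ∈ incidentEigenpairs g := by
    intro x hx s t
    have h1 : v x ∈ x.V₁ := by rw [hv1]; exact Submodule.mem_span_singleton_self _
    have hinc : w x ⬝ᵥ v x = 0 := (hw2 x _).1 (x.le h1)
    have hgv : ∃ c : K, g *ᵥ v x = c • v x := by
      have : e (v x) ∈ (x.map e).V₁ := Submodule.mem_map_of_mem h1
      rw [hx, hv1, Submodule.mem_span_singleton] at this
      obtain ⟨c, hc⟩ := this
      exact ⟨c, by rw [← he, hc]⟩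
    have hgw : ∃ c : K, w x ᵥ* g = c • w x := by
      refine exists_smul_eq_of_orthogonal_le fun u hu => ?_
      rw [← dotProduct_mulVec, ← he, ← hw2, ← hx]
      exact Submodule.mem_map_of_mem ((hw2 x u).2 hu)
    simp only [incidentEigenpairs, mem_filter, mem_univ, true_and]
    refine ⟨smul_ne_zero s.ne_zero (hv x), smul_ne_zero t.ne_zero (hw x), ?_, ?_, ?_⟩
    · rw [smul_dotProduct, dotProduct_smul, hinc, smul_zero, smul_zero]
    · obtain ⟨c, hc⟩ := hgv
      exact ⟨c, by rw [mulVec_smul, hc, smul_comm]⟩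
    · obtain ⟨c, hc⟩ := hgw
      exact ⟨c, by rw [smul_vecMul, hc, smul_comm]⟩
  let F : {x : CompleteFlag K | x.map e = x} × Kˣ × Kˣ → incidentEigenpairs g :=
    fun z => ⟨_, hmem z.1 z.1.2 z.2.1 z.2.2⟩
  have hF : Function.Injective F := by
    rintro ⟨⟨x, hx⟩, s, t⟩ ⟨⟨y, hy⟩, s', t'⟩ h
    simp only [F, Subtype.mk.injEq, Prod.mk.injEq] at h
    obtain ⟨h1, h2⟩ := h
    have hxy : x = y := by
      refine CompleteFlag.ext ?_ ?_
      · rw [hv1, hv1, ← Submodule.span_singleton_smul_eq s.isUnit (v x), h1,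
          Submodule.span_singleton_smul_eq s'.isUnit]
      · ext u
        have hs : ∀ (t : Kˣ) (x : CompleteFlag K), w x ⬝ᵥ u = 0 ↔ ((t : K) • w x) ⬝ᵥ u = 0 := by
          intro t x
          simp
        rw [hw2, hw2, hs t, hs t' y, h2]
    subst hxy
    have hs : s = s' := Units.ext (smul_left_injective K (hv x) h1)
    have ht : t = t' := Units.ext (smul_left_injective K (hw x) h2)
    rw [hs, ht]
  have := Nat.card_le_card_of_injective F hF
  rwa [Nat.card_prod, Nat.card_prod, Nat.card_eq_fintype_card (α := Kˣ), Fintype.card_units, ← sq,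
    Nat.card_eq_fintype_card (α := incidentEigenpairs g), Fintype.card_coe,
    Nat.card_coe_set_eq] at this

end FlagRepresentatives

/-! ### Fixed flags of an element of SL₃(ℤ): the three regimes -/

section FlagAction

open Matrix Finset

/-- The number of flags modulo `q` fixed by `γ`. -/
noncomputable def fixedFlagCount (q : ℕ) [Fact q.Prime] (γ : SL(3, ℤ)) : ℕ :=
  {x : CompleteFlag (ZMod q) | flagAction q γ x = x}.ncard

variable {q : ℕ} [hq : Fact q.Prime]

theorem fixedFlagCount_inv (γ : SL(3, ℤ)) : fixedFlagCount q γ⁻¹ = fixedFlagCount q γ := by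
  rw [fixedFlagCount, fixedFlagCount]
  congr 1
  ext x
  simp only [Set.mem_ofPred_eq, map_inv]
  rw [Equiv.Perm.inv_eq_iff_eq, eq_comm]

theorem fixedFlagCount_mul_le (γ : SL(3, ℤ)) {n : ℕ}
    (h : #(incidentEigenpairs ((γ : Matrix (Fin 3) (Fin 3) ℤ).map (Int.castRingHom (ZMod q)))) ≤
      n * q ^ 2) : fixedFlagCount q γ ≤ 4 * n := by
  have h1 := ncard_fixed_mul_le ((γ : Matrix (Fin 3) (Fin 3) ℤ).map (Int.castRingHom (ZMod q)))
    (Matrix.SpecialLinearGroup.toLin'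
      (Matrix.SpecialLinearGroup.map (Int.castRingHom (ZMod q)) γ)) (fun v => rfl)
  rw [ZMod.card] at h1
  have h2 : fixedFlagCount q γ * (q - 1) ^ 2 ≤ n * q ^ 2 := h1.trans h
  have hq2 := hq.out.two_le
  -- From q ≤ 2(q - 1), as q ≥ 2; this is the source of the factor 4.
  have h3 : q ^ 2 ≤ 4 * (q - 1) ^ 2 := by
    obtain ⟨m, rfl⟩ := Nat.exists_eq_add_of_le hq2
    rw [show 2 + m - 1 = 1 + m by omega]
    nlinarith
  have h4 : 0 < (q - 1) ^ 2 := by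
    have : 0 < q - 1 := by omega
    positivity
  refine Nat.le_of_mul_le_mul_right (h2.trans ?_) h4
  nlinarith

theorem fixedFlagCount_le (γ : SL(3, ℤ)) : fixedFlagCount q γ ≤ 4 * q ^ 3 := by
  refine fixedFlagCount_mul_le γ ((card_incidentEigenpairs_le _).trans ?_)
  rw [ZMod.card, ← pow_add]

theorem fixedFlagCount_le_of_not_scalar (γ : SL(3, ℤ))
    (h : ∀ c : ZMod q, (γ : Matrix (Fin 3) (Fin 3) ℤ).map (Int.castRingHom (ZMod q)) ≠
      scalar (Fin 3) c) : fixedFlagCount q γ ≤ 72 * q := by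
  refine (fixedFlagCount_mul_le γ (n := 18 * q)
    ((card_incidentEigenpairs_le_of_not_scalar h).trans ?_)).trans (by omega)
  rw [ZMod.card]
  apply le_of_eq
  ring

/-- Off the diagonal, the columns of `γ` and of `γ⁻¹` are proportional modulo `q`. -/
def OffDiagProportional (q : ℕ) (a : Matrix (Fin 3) (Fin 3) ℤ) : Prop :=
  ∀ i k j, i ≠ j → k ≠ j → (q : ℤ) ∣ a i j * a.adjugate k j - a k j * a.adjugate i j

theorem fixedFlagCount_le_of_not_proportional (γ : SL(3, ℤ))
    (h : ¬ OffDiagProportional q γ) : fixedFlagCount q γ ≤ 36 := by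
  simp only [OffDiagProportional, not_forall] at h
  obtain ⟨i, k, j, hi, hk, h⟩ := h
  refine fixedFlagCount_mul_le γ (n := 9)
    ((card_incidentEigenpairs_le_of_adjugate hi hk fun e => h ?_).trans ?_)
  · have hadj : ((γ : Matrix (Fin 3) (Fin 3) ℤ).map (Int.castRingHom (ZMod q))).adjugate =
        (γ : Matrix (Fin 3) (Fin 3) ℤ).adjugate.map (Int.castRingHom (ZMod q)) :=
      (RingHom.map_adjugate (Int.castRingHom (ZMod q)) (γ : Matrix (Fin 3) (Fin 3) ℤ)).symm
    rw [hadj] at e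
    simp only [map_apply, eq_intCast] at e
    rw [← ZMod.intCast_zmod_eq_zero_iff_dvd]
    push_cast
    rw [e, sub_self]
  · rw [ZMod.card]

end FlagAction

/-! ### Lattice points in boxes and sums over integer pairs -/

section LatticeCounting

open Finset

/-- A progression of step m meets an interval of length 2R in at most 2R/m + 1 points; `hm` absorbs
the 1 into 3R/m. -/
theorem card_mul_le_of_dvd_sub {A : Finset ℤ} {R m : ℕ} (hm : m ≤ R)
    (hA : ∀ x ∈ A, |x| ≤ (R : ℤ)) (hd : ∀ x ∈ A, ∀ y ∈ A, (m : ℤ) ∣ x - y) :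
    #A * m ≤ 3 * R := by
  rcases Nat.eq_zero_or_pos m with rfl | hm0
  · simp
  rcases A.eq_empty_or_nonempty with rfl | hne
  · simp
  have hx0 := A.min'_mem hne
  have hsub : A ⊆ (range (2 * R / m + 1)).image fun k : ℕ => A.min' hne + m * k := by
    intro x hx
    obtain ⟨k, hk⟩ := hd x hx _ hx0
    have hle := A.min'_le x hx
    have hmz : (0 : ℤ) < m := by exact_mod_cast hm0
    have hk0 : 0 ≤ k := by
      by_contra! h
      nlinarith
    lift k to ℕ using hk0
    refine mem_image.2 ⟨k, mem_range.2 (Nat.lt_succ_of_le ?_), by linarith⟩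
    rw [Nat.le_div_iff_mul_le hm0]
    have h1 := abs_le.1 (hA x hx)
    have h2 := abs_le.1 (hA _ hx0)
    zify
    nlinarith
  have h1 := (card_le_card hsub).trans card_image_le
  rw [card_range] at h1
  calc #A * m ≤ (2 * R / m + 1) * m := by gcongr
    _ = 2 * R / m * m + m := by ring
    _ ≤ 2 * R + R := add_le_add (Nat.div_mul_le_self _ _) hm
    _ = 3 * R := by ring

/-- The maximum norm of a pair of integers. -/
def pairNorm (p : ℤ × ℤ) : ℕ := max p.1.natAbs p.2.natAbs

theorem pairNorm_pos {p : ℤ × ℤ} (hp : p ≠ 0) : 0 < pairNorm p := by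
  rw [pairNorm, lt_max_iff]
  by_contra! h
  apply hp
  ext <;> simp <;> omega

theorem gcd_pos_of_ne_zero {p : ℤ × ℤ} (hp : p ≠ 0) : 0 < Int.gcd p.1 p.2 := by
  rw [Int.gcd_pos_iff]
  by_contra! h
  exact hp (Prod.ext h.1 h.2)

theorem gcd_le_pairNorm {p : ℤ × ℤ} (hp : p ≠ 0) : Int.gcd p.1 p.2 ≤ pairNorm p := by
  rw [pairNorm, le_max_iff]
  by_cases h : p.1 = 0
  · have h2 : p.2 ≠ 0 := fun h2 => hp (Prod.ext h h2)
    exact Or.inr (Nat.le_of_dvd (Int.natAbs_pos.2 h2)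
      (Int.natAbs_dvd_natAbs.2 (Int.gcd_dvd_right _ _)))
  · exact Or.inl (Nat.le_of_dvd (Int.natAbs_pos.2 h)
      (Int.natAbs_dvd_natAbs.2 (Int.gcd_dvd_left _ _)))

/-- Write p = g(u, v) with u, v coprime. For n > 0, two points of Q differ by an integer multiple of
n(u, v), so first coordinates lie in a progression of step n|u| and determine the points. -/
theorem card_mul_le_of_parallel_fst {Q : Finset (ℤ × ℤ)} {p : ℤ × ℤ} (hp : p.1 ≠ 0) {R n : ℕ}
    (hQ : ∀ z ∈ Q, |z.1| ≤ (R : ℤ))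
    (hpar : ∀ z ∈ Q, ∀ z' ∈ Q, (z.1 - z'.1) * p.2 = p.1 * (z.2 - z'.2))
    (hn : ∀ z ∈ Q, ∀ z' ∈ Q, (n : ℤ) ∣ z.1 - z'.1 ∧ (n : ℤ) ∣ z.2 - z'.2)
    (hR : n * p.1.natAbs ≤ R * Int.gcd p.1 p.2) :
    #Q * (n * p.1.natAbs) ≤ 3 * R * Int.gcd p.1 p.2 := by
  have hg : 0 < Int.gcd p.1 p.2 := Int.gcd_pos_iff.2 (Or.inl hp)
  obtain ⟨u, v, huv, h1, h2⟩ := Int.exists_gcd_one hg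
  generalize Int.gcd p.1 p.2 = g at *
  have hgz : (g : ℤ) ≠ 0 := by exact_mod_cast hg.ne'
  have habs : p.1.natAbs = u.natAbs * g := by rw [h1, Int.natAbs_mul, Int.natAbs_natCast]
  have hinj : Set.InjOn Prod.fst (Q : Set (ℤ × ℤ)) := by
    intro z hz z' hz' h
    have := hpar z hz z' hz'
    rw [h, sub_self, zero_mul] at this
    have := (mul_eq_zero.1 this.symm).resolve_left hp
    exact Prod.ext h (sub_eq_zero.1 this)
  have key := card_mul_le_of_dvd_sub (A := Q.image Prod.fst) (R := R) (m := n * u.natAbs) ?_ ?_ ?_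
  · rw [card_image_of_injOn hinj] at key
    rw [habs]
    calc #Q * (n * (u.natAbs * g)) = #Q * (n * u.natAbs) * g := by ring
      _ ≤ 3 * R * g := by gcongr
  · rw [habs, ← mul_assoc] at hR
    exact Nat.le_of_mul_le_mul_right hR hg
  · intro x hx
    obtain ⟨z, hz, rfl⟩ := mem_image.1 hx
    exact hQ z hz
  · intro x hx y hy
    obtain ⟨z, hz, rfl⟩ := mem_image.1 hx
    obtain ⟨z', hz', rfl⟩ := mem_image.1 hy
    obtain ⟨⟨s, hs⟩, t, ht⟩ := hn z hz z' hz'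
    have := hpar z hz z' hz'
    rcases Nat.eq_zero_or_pos n with rfl | hn0
    · simp [hs]
    have hnz : (n : ℤ) ≠ 0 := by exact_mod_cast hn0.ne'
    have h3 : s * v = u * t := by
      apply mul_left_cancel₀ (mul_ne_zero hnz hgz)
      rw [hs, ht, h1, h2] at this
      linear_combination this
    have h4 : u ∣ s := by
      refine IsCoprime.dvd_of_dvd_mul_right (Int.isCoprime_iff_gcd_eq_one.2 huv) ⟨t, h3⟩
    rw [hs]
    push_cast
    exact mul_dvd_mul_left _ ((abs_dvd _ _).2 h4)

theorem card_mul_le_of_parallel {Q : Finset (ℤ × ℤ)} {p : ℤ × ℤ} (hp : p ≠ 0) {R n : ℕ}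
    (hQ : ∀ z ∈ Q, |z.1| ≤ (R : ℤ) ∧ |z.2| ≤ (R : ℤ))
    (hpar : ∀ z ∈ Q, ∀ z' ∈ Q, (z.1 - z'.1) * p.2 = p.1 * (z.2 - z'.2))
    (hn : ∀ z ∈ Q, ∀ z' ∈ Q, (n : ℤ) ∣ z.1 - z'.1 ∧ (n : ℤ) ∣ z.2 - z'.2)
    (hR : n * pairNorm p ≤ R * Int.gcd p.1 p.2) :
    #Q * (n * pairNorm p) ≤ 3 * R * Int.gcd p.1 p.2 := by
  have hpos := pairNorm_pos hp
  rcases le_total p.2.natAbs p.1.natAbs with h | h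
  · have e : pairNorm p = p.1.natAbs := max_eq_left h
    rw [e] at hR hpos ⊢
    exact card_mul_le_of_parallel_fst (Int.natAbs_pos.1 hpos) (fun z hz => (hQ z hz).1) hpar hn hR
  · have e : pairNorm p = p.2.natAbs := max_eq_right h
    rw [e] at hR hpos ⊢
    rw [Int.gcd_comm] at hR ⊢
    have := card_mul_le_of_parallel_fst (Q := Q.image Prod.swap) (p := p.swap) (R := R) (n := n)
      (Int.natAbs_pos.1 hpos) ?_ ?_ ?_ hR
    · rwa [card_image_of_injective _ Prod.swap_injective] at this
    · intro x hx
      obtain ⟨z, hz, rfl⟩ := mem_image.1 hx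
      exact (hQ z hz).2
    · intro x hx y hy
      obtain ⟨z, hz, rfl⟩ := mem_image.1 hx
      obtain ⟨z', hz', rfl⟩ := mem_image.1 hy
      simp only [Prod.fst_swap, Prod.snd_swap]
      linear_combination -(hpar z hz z' hz')
    · intro x hx y hy
      obtain ⟨z, hz, rfl⟩ := mem_image.1 hx
      obtain ⟨z', hz', rfl⟩ := mem_image.1 hy
      exact (hn z hz z' hz').symm

theorem card_mul_le_of_dvd {A : Finset ℤ} {R m : ℕ} (hm : m ≤ R)
    (hA : ∀ x ∈ A, |x| ≤ (R : ℤ)) (hd : ∀ x ∈ A, (m : ℤ) ∣ x) : #A * m ≤ 3 * R :=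
  card_mul_le_of_dvd_sub hm hA fun x hx y hy => dvd_sub (hd x hx) (hd y hy)

theorem card_pairs_mul_le {Q : Finset (ℤ × ℤ)} {g R : ℕ} (hg : g ≤ R)
    (hQ : ∀ z ∈ Q, |z.1| ≤ (R : ℤ) ∧ |z.2| ≤ (R : ℤ))
    (hd : ∀ z ∈ Q, (g : ℤ) ∣ z.1 ∧ (g : ℤ) ∣ z.2) : #Q * (g * g) ≤ 3 * R * (3 * R) := by
  have h1 := card_mul_le_of_dvd (A := Q.image Prod.fst) hg
    (fun x hx => by obtain ⟨z, hz, rfl⟩ := mem_image.1 hx; exact (hQ z hz).1)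
    (fun x hx => by obtain ⟨z, hz, rfl⟩ := mem_image.1 hx; exact (hd z hz).1)
  have h2 := card_mul_le_of_dvd (A := Q.image Prod.snd) hg
    (fun x hx => by obtain ⟨z, hz, rfl⟩ := mem_image.1 hx; exact (hQ z hz).2)
    (fun x hx => by obtain ⟨z, hz, rfl⟩ := mem_image.1 hx; exact (hd z hz).2)
  have h3 : #Q ≤ #(Q.image Prod.fst) * #(Q.image Prod.snd) := by
    rw [← card_product]
    exact card_le_card fun z hz => mem_product.2 ⟨mem_image_of_mem _ hz, mem_image_of_mem _ hz⟩
  calc #Q * (g * g) ≤ #(Q.image Prod.fst) * #(Q.image Prod.snd) * (g * g) := by gcongr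
    _ = (#(Q.image Prod.fst) * g) * (#(Q.image Prod.snd) * g) := by ring
    _ ≤ _ := by gcongr

/-- There are at most 3R/g first coordinates; given one, the determinant congruence fixes the second
modulo q because p.1 is invertible there. -/
theorem card_pairs_mul_le_of_fst {Q : Finset (ℤ × ℤ)} {p : ℤ × ℤ} {g R q : ℕ} (hq : q.Prime)
    (hg : g ≤ R) (hqR : q ≤ R) (hp : ¬ (q : ℤ) ∣ p.1)
    (hQ : ∀ z ∈ Q, |z.1| ≤ (R : ℤ) ∧ |z.2| ≤ (R : ℤ)) (hd : ∀ z ∈ Q, (g : ℤ) ∣ z.1)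
    (hdet : ∀ z ∈ Q, (q : ℤ) ∣ p.1 * z.2 - p.2 * z.1) : #Q * (g * q) ≤ 3 * R * (3 * R) := by
  have h1 := card_mul_le_of_dvd (A := Q.image Prod.fst) hg
    (fun x hx => by obtain ⟨z, hz, rfl⟩ := mem_image.1 hx; exact (hQ z hz).1)
    (fun x hx => by obtain ⟨z, hz, rfl⟩ := mem_image.1 hx; exact hd z hz)
  have h2 : #Q ≤ 3 * R / q * #(Q.image Prod.fst) := by
    refine card_le_mul_card_image Q _ fun x _ => ?_
    rw [Nat.le_div_iff_mul_le hq.pos]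
    have hinj : Set.InjOn Prod.snd (({z ∈ Q | z.1 = x} : Finset (ℤ × ℤ)) : Set (ℤ × ℤ)) := by
      intro z hz z' hz' h
      rw [mem_coe, mem_filter] at hz hz'
      exact Prod.ext (hz.2.trans hz'.2.symm) h
    rw [← card_image_of_injOn hinj]
    refine card_mul_le_of_dvd_sub hqR ?_ ?_
    · intro y hy
      obtain ⟨z, hz, rfl⟩ := mem_image.1 hy
      exact (hQ z (mem_filter.1 hz).1).2
    · intro y hy y' hy'
      obtain ⟨z, hz, rfl⟩ := mem_image.1 hy
      obtain ⟨z', hz', rfl⟩ := mem_image.1 hy'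
      rw [mem_filter] at hz hz'
      have h := dvd_sub (hdet z hz.1) (hdet z' hz'.1)
      rw [hz.2, hz'.2, show p.1 * z.2 - p.2 * x - (p.1 * z'.2 - p.2 * x) = p.1 * (z.2 - z'.2) by
        ring] at h
      exact ((Nat.prime_iff_prime_int.1 hq).dvd_or_dvd h).resolve_left hp
  calc #Q * (g * q) ≤ 3 * R / q * #(Q.image Prod.fst) * (g * q) := by gcongr
    _ = (#(Q.image Prod.fst) * g) * (3 * R / q * q) := by ring
    _ ≤ _ := Nat.mul_le_mul h1 (Nat.div_mul_le_self _ _)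

/-- If q divides p, the congruence is void, but then q ≤ g and the bound with g^2 is stronger.
Otherwise one coordinate of p is invertible modulo q. -/
theorem card_pairs_mul_le_of_det {Q : Finset (ℤ × ℤ)} {p : ℤ × ℤ} (hp0 : p ≠ 0) {R q : ℕ}
    (hq : q.Prime) (hg : Int.gcd p.1 p.2 ≤ R) (hqR : q ≤ R)
    (hQ : ∀ z ∈ Q, |z.1| ≤ (R : ℤ) ∧ |z.2| ≤ (R : ℤ))
    (hd : ∀ z ∈ Q, (Int.gcd p.1 p.2 : ℤ) ∣ z.1 ∧ (Int.gcd p.1 p.2 : ℤ) ∣ z.2)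
    (hdet : ∀ z ∈ Q, (q : ℤ) ∣ p.1 * z.2 - p.2 * z.1) :
    #Q * (Int.gcd p.1 p.2 * q) ≤ 3 * R * (3 * R) := by
  by_cases h1 : (q : ℤ) ∣ p.1
  · by_cases h2 : (q : ℤ) ∣ p.2
    · have h3 : q ≤ Int.gcd p.1 p.2 :=
        Nat.le_of_dvd (gcd_pos_of_ne_zero hp0) (Int.dvd_gcd h1 h2)
      calc #Q * (Int.gcd p.1 p.2 * q) ≤ #Q * (Int.gcd p.1 p.2 * Int.gcd p.1 p.2) := by gcongr
        _ ≤ _ := card_pairs_mul_le hg hQ hd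
    · have := card_pairs_mul_le_of_fst (Q := Q.image Prod.swap) (p := p.swap) hq hg hqR h2
        (fun x hx => by obtain ⟨z, hz, rfl⟩ := mem_image.1 hx; exact (hQ z hz).symm)
        (fun x hx => by obtain ⟨z, hz, rfl⟩ := mem_image.1 hx; exact (hd z hz).2)
        (fun x hx => by
          obtain ⟨z, hz, rfl⟩ := mem_image.1 hx
          simpa [neg_sub] using (dvd_neg.2 (hdet z hz)))
      rwa [card_image_of_injective _ Prod.swap_injective] at this
  · exact card_pairs_mul_le_of_fst hq hg hqR h1 hQ (fun z hz => (hd z hz).1) hdet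

/-- The sum of `1 / (x + 1)` over `0 ≤ x ≤ R`. -/
noncomputable def harmonicSum (R : ℕ) : ℝ := ∑ x ∈ range (R + 1), (1 : ℝ) / (x + 1)

/-- The pairs of integers of absolute value at most `R`, except `(0, 0)`. -/
noncomputable def puncturedBox (R : ℕ) : Finset (ℤ × ℤ) :=
  {p ∈ Icc (-R : ℤ) R ×ˢ Icc (-R : ℤ) R | p ≠ 0}

theorem mem_puncturedBox {R : ℕ} {p : ℤ × ℤ} :
    p ∈ puncturedBox R ↔ (|p.1| ≤ R ∧ |p.2| ≤ R) ∧ p ≠ 0 := by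
  simp [puncturedBox, abs_le]

theorem pairNorm_le_of_mem_puncturedBox {R : ℕ} {p : ℤ × ℤ} (hp : p ∈ puncturedBox R) :
    pairNorm p ≤ R := by
  have := (mem_puncturedBox.1 hp).1
  rw [Int.abs_eq_natAbs, Int.abs_eq_natAbs] at this
  rw [pairNorm]
  omega

theorem one_le_harmonicSum (R : ℕ) : 1 ≤ harmonicSum R := by
  have := single_le_sum (f := fun x : ℕ => (1 : ℝ) / (x + 1)) (s := range (R + 1))
    (fun i _ => by positivity) (mem_range.2 (Nat.succ_pos R))
  simpa [harmonicSum] using this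

theorem sum_Icc_le_harmonicSum (R : ℕ) :
    ∑ x ∈ Icc (-R : ℤ) R, (1 : ℝ) / (x.natAbs + 1) ≤ 2 * harmonicSum R := by
  have hsub : Icc (-R : ℤ) R ⊆ (range (R + 1)).image (fun n : ℕ => (n : ℤ)) ∪
      (range (R + 1)).image (fun n : ℕ => -(n : ℤ)) := by
    intro x hx
    rw [mem_Icc] at hx
    simp only [mem_union, mem_image, mem_range]
    rcases le_total 0 x with h | h
    · exact Or.inl ⟨x.natAbs, by omega, by omega⟩
    · exact Or.inr ⟨x.natAbs, by omega, by omega⟩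
  refine (sum_le_sum_of_subset_of_nonneg hsub fun x _ _ => by positivity).trans ?_
  have hinter := sum_union_inter (s₁ := (range (R + 1)).image (fun n : ℕ => (n : ℤ)))
    (s₂ := (range (R + 1)).image (fun n : ℕ => -(n : ℤ)))
    (f := fun x : ℤ => (1 : ℝ) / (x.natAbs + 1))
  have h0 : 0 ≤ ∑ x ∈ (range (R + 1)).image (fun n : ℕ => (n : ℤ)) ∩
      (range (R + 1)).image (fun n : ℕ => -(n : ℤ)), (1 : ℝ) / (x.natAbs + 1) :=
    sum_nonneg fun x _ => by positivity
  rw [sum_image (fun a _ b _ h => by simpa using h),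
    sum_image (fun a _ b _ h => by simpa using h)] at hinter
  simp only [Int.natAbs_neg, Int.natAbs_natCast] at hinter
  rw [← harmonicSum] at hinter
  linarith

/-- As |x| + 1 ≤ 2|p| and |y| + 1 ≤ 2|p| for p = (x, y) nonzero, the sum is dominated by a product
of two harmonic sums. -/
theorem sum_puncturedBox_le (R : ℕ) :
    ∑ p ∈ puncturedBox R, (1 : ℝ) / (pairNorm p) ^ 2 ≤ 16 * harmonicSum R ^ 2 := by
  calc ∑ p ∈ puncturedBox R, (1 : ℝ) / (pairNorm p) ^ 2
      ≤ ∑ p ∈ puncturedBox R, 4 * ((1 : ℝ) / (p.1.natAbs + 1) * (1 / (p.2.natAbs + 1))) := by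
        refine sum_le_sum fun p hp => ?_
        have hpos : (1 : ℝ) ≤ pairNorm p := by
          exact_mod_cast pairNorm_pos (mem_puncturedBox.1 hp).2
        have h1 : (p.1.natAbs : ℝ) ≤ pairNorm p := by exact_mod_cast le_max_left _ _
        have h2 : (p.2.natAbs : ℝ) ≤ pairNorm p := by exact_mod_cast le_max_right _ _
        rw [one_div_mul_one_div, mul_one_div, div_le_div_iff₀ (by positivity) (by positivity)]
        have : ((p.1.natAbs : ℝ) + 1) * (p.2.natAbs + 1) ≤ (2 * pairNorm p) * (2 * pairNorm p) := by
          gcongr <;> linarith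
        linarith
    _ ≤ ∑ p ∈ Icc (-R : ℤ) R ×ˢ Icc (-R : ℤ) R,
          4 * ((1 : ℝ) / (p.1.natAbs + 1) * (1 / (p.2.natAbs + 1))) :=
        sum_le_sum_of_subset_of_nonneg (filter_subset _ _) fun p _ _ => by positivity
    _ = 4 * ((∑ x ∈ Icc (-R : ℤ) R, (1 : ℝ) / (x.natAbs + 1)) *
          ∑ x ∈ Icc (-R : ℤ) R, (1 : ℝ) / (x.natAbs + 1)) := by
        rw [← mul_sum, sum_mul_sum, sum_product]
    _ ≤ 4 * ((2 * harmonicSum R) * (2 * harmonicSum R)) := by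
        have := sum_Icc_le_harmonicSum R
        have h0 : 0 ≤ ∑ x ∈ Icc (-R : ℤ) R, (1 : ℝ) / (x.natAbs + 1) :=
          sum_nonneg fun x _ => by positivity
        have h1 := one_le_harmonicSum R
        gcongr
    _ = 16 * harmonicSum R ^ 2 := by ring

theorem sum_puncturedBox_dvd_le (R : ℕ) {d : ℕ} (hd : 0 < d) :
    ∑ p ∈ puncturedBox R with (d : ℤ) ∣ p.1 ∧ (d : ℤ) ∣ p.2, (1 : ℝ) / (pairNorm p) ^ 2 ≤
      16 * harmonicSum R ^ 2 / d ^ 2 := by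
  have hdz : (d : ℤ) ≠ 0 := by exact_mod_cast hd.ne'
  have hsub : {p ∈ puncturedBox R | (d : ℤ) ∣ p.1 ∧ (d : ℤ) ∣ p.2} ⊆
      (puncturedBox R).image fun p => ((d : ℤ) * p.1, (d : ℤ) * p.2) := by
    rintro ⟨x, y⟩ hp
    simp only [mem_filter, mem_puncturedBox] at hp
    obtain ⟨⟨⟨hx, hy⟩, h0⟩, ⟨u, rfl⟩, ⟨v, rfl⟩⟩ := hp
    refine mem_image.2 ⟨(u, v), mem_puncturedBox.2 ⟨⟨?_, ?_⟩, ?_⟩, rfl⟩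
    · rw [abs_mul, Nat.abs_cast] at hx
      exact (le_mul_of_one_le_left (abs_nonneg u) (by exact_mod_cast hd)).trans hx
    · rw [abs_mul, Nat.abs_cast] at hy
      exact (le_mul_of_one_le_left (abs_nonneg v) (by exact_mod_cast hd)).trans hy
    · rintro h
      simp only [Prod.mk_eq_zero] at h
      simp [h] at h0
  have hinj : Function.Injective fun p : ℤ × ℤ => ((d : ℤ) * p.1, (d : ℤ) * p.2) := by
    intro p p' h
    simp only [Prod.mk.injEq, mul_right_inj' hdz] at h
    exact Prod.ext h.1 h.2
  refine (sum_le_sum_of_subset_of_nonneg hsub fun x _ _ => by positivity).trans ?_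
  rw [sum_image hinj.injOn]
  have : ∀ p : ℤ × ℤ, (1 : ℝ) / (pairNorm ((d : ℤ) * p.1, (d : ℤ) * p.2)) ^ 2 =
      1 / (pairNorm p) ^ 2 / d ^ 2 := by
    intro p
    rw [div_div, ← mul_pow]
    congr 2
    simp only [pairNorm, Int.natAbs_mul, Int.natAbs_natCast]
    rw [Nat.mul_max_mul_left]
    push_cast
    ring
  simp only [this]
  rw [← sum_div]
  gcongr
  exact sum_puncturedBox_le R

/-- Bound the gcd by the sum of all its divisors d. The pairs divisible by d contribute
d·O(H^2/d^2), so summing over d costs one more harmonic sum. -/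
theorem sum_gcd_div_le (R : ℕ) :
    ∑ p ∈ puncturedBox R, (Int.gcd p.1 p.2 : ℝ) / (pairNorm p) ^ 2 ≤ 16 * harmonicSum R ^ 3 := by
  calc ∑ p ∈ puncturedBox R, (Int.gcd p.1 p.2 : ℝ) / (pairNorm p) ^ 2
      ≤ ∑ p ∈ puncturedBox R, ∑ k ∈ range (R + 1),
          if ((k + 1 : ℕ) : ℤ) ∣ p.1 ∧ ((k + 1 : ℕ) : ℤ) ∣ p.2 then
            ((k + 1 : ℕ) : ℝ) * (1 / (pairNorm p) ^ 2) else 0 := by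
        refine sum_le_sum fun p hp => ?_
        have h0 := (mem_puncturedBox.1 hp).2
        have hg := gcd_pos_of_ne_zero h0
        have hle := (gcd_le_pairNorm h0).trans (pairNorm_le_of_mem_puncturedBox hp)
        -- The index is shifted by one: the term k = gcd - 1 alone gives the left side.
        have hmem : Int.gcd p.1 p.2 - 1 ∈ range (R + 1) := mem_range.2 (by omega)
        refine le_trans ?_ (single_le_sum (fun k _ => ?_) hmem)
        · rw [Nat.sub_add_cancel hg, if_pos ⟨Int.gcd_dvd_left _ _, Int.gcd_dvd_right _ _⟩,
            mul_one_div]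
        · split_ifs <;> positivity
    _ = ∑ k ∈ range (R + 1), ((k + 1 : ℕ) : ℝ) *
          ∑ p ∈ puncturedBox R with ((k + 1 : ℕ) : ℤ) ∣ p.1 ∧ ((k + 1 : ℕ) : ℤ) ∣ p.2,
            (1 : ℝ) / (pairNorm p) ^ 2 := by
        rw [sum_comm]
        refine sum_congr rfl fun k _ => ?_
        rw [← sum_filter, mul_sum]
    _ ≤ ∑ k ∈ range (R + 1), ((k + 1 : ℕ) : ℝ) *
          (16 * harmonicSum R ^ 2 / ((k + 1 : ℕ) : ℝ) ^ 2) := by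
        gcongr with k hk
        exact sum_puncturedBox_dvd_le R (Nat.succ_pos k)
    _ = 16 * harmonicSum R ^ 2 * ∑ k ∈ range (R + 1), (1 : ℝ) / (k + 1) := by
        rw [mul_sum]
        refine sum_congr rfl fun k _ => ?_
        push_cast
        field_simp
    _ = 16 * harmonicSum R ^ 3 := by
        rw [← harmonicSum]
        ring

end LatticeCounting

/-! ### Counting matrices in a dyadic shell -/

section MatrixCounting

open Finset

/-- With the first two rows fixed, the third changes by X₀·row₀ + X₁·row₁, which subtracts X₀ and X₁
times the last column of the adjugate from its first two columns. That column has an entry of size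
at least S while all entries are at most 2S, so |X₀|, |X₁| ≤ 4: 9·9 choices. -/
theorem card_le_of_rows_eq {G : Finset (Matrix (Fin 3) (Fin 3) ℤ)} {S : ℕ} (hS : 0 < S)
    (hdet : ∀ a ∈ G, a.det = 1) (hrow : ∀ a ∈ G, ∀ a' ∈ G, a 0 = a' 0 ∧ a 1 = a' 1)
    (hb : ∀ a ∈ G, ∀ i j, |a.adjugate i j| ≤ 2 * (S : ℤ))
    (hc : ∀ a ∈ G, ∃ i, (S : ℤ) ≤ |a.adjugate i 2|) : #G ≤ 81 := by
  rcases G.eq_empty_or_nonempty with rfl | ⟨m, hm⟩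
  · simp
  have hSz : (0 : ℤ) < S := by exact_mod_cast hS
  have hmul : m.adjugate * m = 1 := by rw [Matrix.adjugate_mul, hdet m hm, one_smul]
  -- Coordinates of the third row of a in the basis of the rows of m; the last one is 1 because the
  -- determinants agree.
  let X : Matrix (Fin 3) (Fin 3) ℤ → Fin 3 → ℤ := fun a => Matrix.vecMul (a 2) m.adjugate
  have hX2 : ∀ a ∈ G, X a 2 = 1 := by
    intro a ha
    rw [← hdet a ha, Matrix.det_fin_three]
    simp only [X, Matrix.vecMul, dotProduct, Fin.sum_univ_three, Matrix.adjugate_fin_three]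
    obtain ⟨h0, h1⟩ := hrow a ha m hm
    simp [h0, h1]
    ring
  have hrow2 : ∀ a ∈ G, ∀ j, a 2 j = X a 0 * m 0 j + X a 1 * m 1 j + m 2 j := by
    intro a ha j
    have : Matrix.vecMul (X a) m = a 2 := by rw [Matrix.vecMul_vecMul, hmul, Matrix.vecMul_one]
    rw [← this, Matrix.vecMul, dotProduct, Fin.sum_univ_three, hX2 a ha, one_mul]
  have hcol : ∀ a ∈ G, ∀ i, a.adjugate i 0 = m.adjugate i 0 - X a 0 * m.adjugate i 2 ∧
      a.adjugate i 1 = m.adjugate i 1 - X a 1 * m.adjugate i 2 := by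
    intro a ha i
    have h2 := hrow2 a ha
    obtain ⟨h0, h1⟩ := hrow a ha m hm
    generalize X a = x at h2
    rw [Matrix.adjugate_fin_three, Matrix.adjugate_fin_three]
    fin_cases i <;> simp [h0, h1, h2] <;> constructor <;> ring
  obtain ⟨i, hi⟩ := hc m hm
  have hbound : ∀ x s t : ℤ, |s| ≤ 2 * (S : ℤ) → |t| ≤ 2 * (S : ℤ) →
      s = t - x * m.adjugate i 2 → x ∈ Icc (-4 : ℤ) 4 := by
    intro x s t hs ht h
    have h1 : |x| * S ≤ 4 * S := by
      calc |x| * S ≤ |x| * |m.adjugate i 2| := by gcongr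
        _ = |t - s| := by rw [← abs_mul, h]; congr 1; ring
        _ ≤ |t| + |s| := abs_sub _ _
        _ ≤ 4 * S := by linarith
    exact mem_Icc.2 (abs_le.1 (le_of_mul_le_mul_right h1 hSz))
  calc #G ≤ #(Icc (-4 : ℤ) 4 ×ˢ Icc (-4 : ℤ) 4) := by
        refine card_le_card_of_injOn (fun a => (X a 0, X a 1)) ?_ ?_
        · intro a ha
          exact mem_coe.2 (mem_product.2
            ⟨hbound _ _ _ (hb a ha i 0) (hb m hm i 0) (hcol a ha i).1,
              hbound _ _ _ (hb a ha i 1) (hb m hm i 1) (hcol a ha i).2⟩)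
        · intro a ha a' ha' h
          simp only [Prod.mk.injEq] at h
          have e := hrow a ha a' ha'
          ext k j
          fin_cases k
          · exact congrFun e.1 j
          · exact congrFun e.2 j
          · exact (hrow2 a ha j).trans (by rw [h.1, h.2]; exact (hrow2 a' ha' j).symm)
    _ = 81 := by simp

/-- The two upper entries of the last column. -/
def upperColumn (a : Matrix (Fin 3) (Fin 3) ℤ) : ℤ × ℤ := (a 0 2, a 1 2)

/-- A finite set of integer matrices of determinant `1` with entries at most `R`, whose inverses
have entries at most `2 * S`, with an entry at least `S` in the last column. -/
structure IsShell (G : Finset (Matrix (Fin 3) (Fin 3) ℤ)) (R S : ℕ) : Prop where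
  det : ∀ a ∈ G, a.det = 1
  entry_le : ∀ a ∈ G, ∀ i j, |a i j| ≤ (R : ℤ)
  adjugate_le : ∀ a ∈ G, ∀ i j, |a.adjugate i j| ≤ 2 * (S : ℤ)
  le_adjugate : ∀ a ∈ G, ∃ i, (S : ℤ) ≤ |a.adjugate i 2|

namespace IsShell

variable {G : Finset (Matrix (Fin 3) (Fin 3) ℤ)} {R S : ℕ}

theorem mono (h : IsShell G R S) {G' : Finset (Matrix (Fin 3) (Fin 3) ℤ)} (hG : G' ⊆ G) :
    IsShell G' R S :=
  ⟨fun a ha => h.det a (hG ha), fun a ha => h.entry_le a (hG ha),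
    fun a ha => h.adjugate_le a (hG ha), fun a ha => h.le_adjugate a (hG ha)⟩

/-- If p = 0, the last column of the adjugate is (0, 0, ±1), which `S ≥ 2` rules out. Hence matrices
with small inverse are counted separately. -/
theorem upperColumn_mem (h : IsShell G R S) (hS : 2 ≤ S) {a : Matrix (Fin 3) (Fin 3) ℤ}
    (ha : a ∈ G) : upperColumn a ∈ puncturedBox R := by
  refine mem_puncturedBox.2 ⟨⟨h.entry_le a ha 0 2, h.entry_le a ha 1 2⟩, fun h0 => ?_⟩
  simp only [upperColumn, Prod.mk_eq_zero] at h0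
  have hmul : (a * a.adjugate) 2 2 = 1 := by rw [Matrix.mul_adjugate, h.det a ha]; simp
  obtain ⟨i, hi⟩ := h.le_adjugate a ha
  have h02 : a.adjugate 0 2 = 0 := by rw [Matrix.adjugate_fin_three]; simp [h0]
  have h12 : a.adjugate 1 2 = 0 := by rw [Matrix.adjugate_fin_three]; simp [h0]
  rw [Matrix.mul_apply, Fin.sum_univ_three, h02, h12, mul_zero, mul_zero, zero_add,
    zero_add] at hmul
  have hu : |a.adjugate 2 2| = 1 := Int.isUnit_iff_abs_eq.1 (IsUnit.of_mul_eq_one_right _ hmul)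
  have : (2 : ℤ) ≤ S := by exact_mod_cast hS
  fin_cases i
  · change (S : ℤ) ≤ |a.adjugate 0 2| at hi
    rw [h02, abs_zero] at hi
    omega
  · change (S : ℤ) ≤ |a.adjugate 1 2| at hi
    rw [h12, abs_zero] at hi
    omega
  · change (S : ℤ) ≤ |a.adjugate 2 2| at hi
    omega

theorem gcd_dvd_adjugate (a : Matrix (Fin 3) (Fin 3) ℤ) :
    (Int.gcd (upperColumn a).1 (upperColumn a).2 : ℤ) ∣ (upperColumn a.adjugate).1 ∧
    (Int.gcd (upperColumn a).1 (upperColumn a).2 : ℤ) ∣ (upperColumn a.adjugate).2 := by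
  have h1 : (Int.gcd (upperColumn a).1 (upperColumn a).2 : ℤ) ∣ a 0 2 := Int.gcd_dvd_left _ _
  have h2 : (Int.gcd (upperColumn a).1 (upperColumn a).2 : ℤ) ∣ a 1 2 := Int.gcd_dvd_right _ _
  generalize (Int.gcd (upperColumn a).1 (upperColumn a).2 : ℤ) = g at h1 h2
  rw [upperColumn, Matrix.adjugate_fin_three]
  exact ⟨dvd_sub (dvd_mul_of_dvd_right h2 _) (dvd_mul_of_dvd_left h1 _),
    dvd_add (dvd_neg.2 (dvd_mul_of_dvd_right h2 _)) (dvd_mul_of_dvd_left h1 _)⟩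

/-- Fixing s fixes the determinants of p with the other two upper columns, so each of these runs
over a line of direction p. The constant is 729 = 81·3^2. -/
theorem card_le_of_columns_eq (h : IsShell G R S) (hS : 2 ≤ S) {n : ℕ} (hn : 0 < n)
    {p s : ℤ × ℤ} (hp : ∀ a ∈ G, upperColumn a = p) (hs : ∀ a ∈ G, upperColumn a.adjugate = s)
    (hpR : p ∈ puncturedBox R) (hpn : (n : ℤ) ∣ p.1 ∧ (n : ℤ) ∣ p.2)
    (hdvd : ∀ a ∈ G, ∀ a' ∈ G, ∀ i j, (n : ℤ) ∣ a i j - a' i j) :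
    (#G : ℝ) ≤ 729 * ((R * Int.gcd p.1 p.2 : ℝ) / (n * pairNorm p)) ^ 2 := by
  have hp0 := (mem_puncturedBox.1 hpR).2
  -- Uses n ≤ gcd, as n divides the nonzero p, and |p| ≤ R.
  have hR : n * pairNorm p ≤ R * Int.gcd p.1 p.2 := by
    rw [mul_comm]
    exact Nat.mul_le_mul (pairNorm_le_of_mem_puncturedBox hpR)
      (Nat.le_of_dvd (gcd_pos_of_ne_zero hp0) (Int.dvd_gcd hpn.1 hpn.2))
  have h02 : ∀ a ∈ G, a 0 2 = p.1 := fun a ha => congrArg Prod.fst (hp a ha)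
  have h12 : ∀ a ∈ G, a 1 2 = p.2 := fun a ha => congrArg Prod.snd (hp a ha)
  have hs1 : ∀ a ∈ G, a 0 1 * p.2 - p.1 * a 1 1 = s.1 := by
    intro a ha
    rw [← hs a ha, ← h02 a ha, ← h12 a ha, upperColumn, Matrix.adjugate_fin_three]
    rfl
  have hs2 : ∀ a ∈ G, -(a 0 0 * p.2) + p.1 * a 1 0 = s.2 := by
    intro a ha
    rw [← hs a ha, ← h02 a ha, ← h12 a ha, upperColumn, Matrix.adjugate_fin_three]
    rfl
  have hcol : ∀ j : Fin 3, (∀ a ∈ G, ∀ a' ∈ G,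
      (a 0 j - a' 0 j) * p.2 = p.1 * (a 1 j - a' 1 j)) →
      #(G.image fun a => (a 0 j, a 1 j)) * (n * pairNorm p) ≤ 3 * R * Int.gcd p.1 p.2 := by
    intro j hj
    refine card_mul_le_of_parallel hp0 ?_ ?_ ?_ hR
    · intro z hz
      obtain ⟨a, ha, rfl⟩ := mem_image.1 hz
      exact ⟨h.entry_le a ha 0 j, h.entry_le a ha 1 j⟩
    · intro z hz z' hz'
      obtain ⟨a, ha, rfl⟩ := mem_image.1 hz
      obtain ⟨a', ha', rfl⟩ := mem_image.1 hz'
      exact hj a ha a' ha'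
    · intro z hz z' hz'
      obtain ⟨a, ha, rfl⟩ := mem_image.1 hz
      obtain ⟨a', ha', rfl⟩ := mem_image.1 hz'
      exact ⟨hdvd a ha a' ha' 0 j, hdvd a ha a' ha' 1 j⟩
  have hQ0 := hcol 0 fun a ha a' ha' => by linear_combination hs2 a' ha' - hs2 a ha
  have hQ1 := hcol 1 fun a ha a' ha' => by linear_combination hs1 a ha - hs1 a' ha'
  have hrows : #(G.image fun a => (a 0, a 1)) ≤
      #(G.image fun a => (a 0 0, a 1 0)) * #(G.image fun a => (a 0 1, a 1 1)) := by
    rw [← card_product]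
    refine card_le_card_of_injOn (fun r => ((r.1 0, r.2 0), (r.1 1, r.2 1))) ?_ ?_
    · intro r hr
      obtain ⟨a, ha, rfl⟩ := mem_image.1 hr
      exact mem_coe.2 (mem_product.2 ⟨mem_image_of_mem _ ha, mem_image_of_mem _ ha⟩)
    · intro r hr r' hr' e
      obtain ⟨a, ha, rfl⟩ := mem_image.1 hr
      obtain ⟨a', ha', rfl⟩ := mem_image.1 hr'
      simp only [Prod.mk.injEq] at e ⊢
      constructor <;> ext j <;> fin_cases j
      exacts [e.1.1, e.2.1, (h02 a ha).trans (h02 a' ha').symm, e.1.2, e.2.2,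
        (h12 a ha).trans (h12 a' ha').symm]
  have hG : #G ≤ 81 * #(G.image fun a => (a 0, a 1)) := by
    refine card_le_mul_card_image G 81 fun r _ => ?_
    have hsub := h.mono (filter_subset (fun a => (a 0, a 1) = r) G)
    refine card_le_of_rows_eq (by omega) hsub.det ?_ hsub.adjugate_le hsub.le_adjugate
    intro a ha a' ha'
    have := (mem_filter.1 ha).2.trans (mem_filter.1 ha').2.symm
    simpa using this
  have hpos : (0 : ℝ) < n * pairNorm p := by
    have := pairNorm_pos hp0
    positivity
  have real_le : ∀ c : ℕ, c * (n * pairNorm p) ≤ 3 * R * Int.gcd p.1 p.2 →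
      (c : ℝ) ≤ 3 * ((R * Int.gcd p.1 p.2 : ℝ) / (n * pairNorm p)) := by
    intro c hc
    rw [← mul_div_assoc, le_div_iff₀ hpos, ← mul_assoc 3]
    exact_mod_cast hc
  calc (#G : ℝ) ≤ 81 * (#(G.image fun a => (a 0 0, a 1 0)) *
        #(G.image fun a => (a 0 1, a 1 1))) := by
        exact_mod_cast hG.trans (Nat.mul_le_mul_left _ hrows)
    _ ≤ 81 * ((3 * ((R * Int.gcd p.1 p.2 : ℝ) / (n * pairNorm p))) *
        (3 * ((R * Int.gcd p.1 p.2 : ℝ) / (n * pairNorm p)))) := by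
        gcongr
        exacts [real_le _ hQ0, real_le _ hQ1]
    _ = _ := by ring

/-- Fibre over p, then over s; σ bounds the number of s and is where proportionality modulo q will
enter. -/
theorem card_le_sum (h : IsShell G R S) (hS : 2 ≤ S) {n : ℕ} (hn : 0 < n)
    (hGn : ∀ a ∈ G, (n : ℤ) ∣ a 0 2 ∧ (n : ℤ) ∣ a 1 2)
    (hdvd : ∀ a ∈ G, ∀ a' ∈ G, ∀ i j, (n : ℤ) ∣ a i j - a' i j) (σ : ℤ × ℤ → ℝ)
    (hσ : ∀ p ∈ puncturedBox R,
      (#({a ∈ G | upperColumn a = p}.image fun a => upperColumn a.adjugate) : ℝ) ≤ σ p) :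
    (#G : ℝ) ≤ ∑ p ∈ puncturedBox R with (n : ℤ) ∣ p.1 ∧ (n : ℤ) ∣ p.2,
      729 * ((R * Int.gcd p.1 p.2 : ℝ) / (n * pairNorm p)) ^ 2 * σ p := by
  have hmaps : Set.MapsTo upperColumn (G : Set (Matrix (Fin 3) (Fin 3) ℤ))
      ({p ∈ puncturedBox R | (n : ℤ) ∣ p.1 ∧ (n : ℤ) ∣ p.2} : Finset (ℤ × ℤ)) :=
    fun a ha => mem_coe.2 (mem_filter.2 ⟨h.upperColumn_mem hS ha, hGn a ha⟩)
  rw [card_eq_sum_card_fiberwise hmaps]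
  push_cast
  refine sum_le_sum fun p hp => ?_
  rw [mem_filter] at hp
  set B : ℝ := 729 * ((R * Int.gcd p.1 p.2 : ℝ) / (n * pairNorm p)) ^ 2
  have hB0 : 0 ≤ B := by positivity
  have hcard : #{a ∈ G | upperColumn a = p} ≤
      ⌊B⌋₊ * #({a ∈ G | upperColumn a = p}.image fun a => upperColumn a.adjugate) := by
    refine card_le_mul_card_image _ _ fun s _ => Nat.le_floor ?_
    have hsub : {a ∈ {a ∈ G | upperColumn a = p} | upperColumn a.adjugate = s} ⊆ G :=
      (filter_subset _ _).trans (filter_subset _ _)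
    exact (h.mono hsub).card_le_of_columns_eq hS hn
      (fun a ha => (mem_filter.1 (mem_filter.1 ha).1).2) (fun a ha => (mem_filter.1 ha).2)
      hp.1 hp.2 (fun a ha a' ha' => hdvd a (hsub ha) a' (hsub ha'))
  calc (#{a ∈ G | upperColumn a = p} : ℝ) ≤ ⌊B⌋₊ *
        #({a ∈ G | upperColumn a = p}.image fun a => upperColumn a.adjugate) := by
        exact_mod_cast hcard
    _ ≤ B * σ p := by
        gcongr
        exacts [Nat.floor_le hB0, hσ p hp.1]

theorem adjugate_image_bounds (h : IsShell G R S) {p : ℤ × ℤ} :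
    ∀ z ∈ {a ∈ G | upperColumn a = p}.image fun a => upperColumn a.adjugate,
      (|z.1| ≤ ((2 * S : ℕ) : ℤ) ∧ |z.2| ≤ ((2 * S : ℕ) : ℤ)) ∧
      ((Int.gcd p.1 p.2 : ℤ) ∣ z.1 ∧ (Int.gcd p.1 p.2 : ℤ) ∣ z.2) := by
  intro z hz
  obtain ⟨a, ha, rfl⟩ := mem_image.1 hz
  obtain ⟨haG, rfl⟩ := mem_filter.1 ha
  push_cast
  exact ⟨⟨h.adjugate_le a haG 0 2, h.adjugate_le a haG 1 2⟩, gcd_dvd_adjugate a⟩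

/-- The factor g^2 from the lines cancels against (6S/g)^2. The congruences give n^-2 from the lines
and n^-2 from the sum over p. -/
theorem card_le (h : IsShell G R S) (hS : 2 ≤ S) (hRS : R ≤ 2 * S) {n : ℕ} (hn : 0 < n)
    (hGn : ∀ a ∈ G, (n : ℤ) ∣ a 0 2 ∧ (n : ℤ) ∣ a 1 2)
    (hdvd : ∀ a ∈ G, ∀ a' ∈ G, ∀ i j, (n : ℤ) ∣ a i j - a' i j) :
    (#G : ℝ) ≤ 419904 * (R * S) ^ 2 * harmonicSum R ^ 2 / n ^ 4 := by
  refine (h.card_le_sum hS hn hGn hdvd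
    (fun p => (6 * S / Int.gcd p.1 p.2 : ℝ) ^ 2) fun p hp => ?_).trans ?_
  · have hp0 := (mem_puncturedBox.1 hp).2
    have hg : (0 : ℝ) < Int.gcd p.1 p.2 := by exact_mod_cast gcd_pos_of_ne_zero hp0
    have := card_pairs_mul_le
      (((gcd_le_pairNorm hp0).trans (pairNorm_le_of_mem_puncturedBox hp)).trans hRS)
      (fun z hz => (h.adjugate_image_bounds z hz).1) (fun z hz => (h.adjugate_image_bounds z hz).2)
    rw [div_pow, le_div_iff₀ (by positivity), sq, sq,
      show (6 * S : ℝ) * (6 * S) = 3 * (2 * S) * (3 * (2 * S)) by ring]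
    exact_mod_cast this
  · calc ∑ p ∈ puncturedBox R with (n : ℤ) ∣ p.1 ∧ (n : ℤ) ∣ p.2,
          729 * ((R * Int.gcd p.1 p.2 : ℝ) / (n * pairNorm p)) ^ 2 *
            (6 * S / Int.gcd p.1 p.2 : ℝ) ^ 2
        = 26244 * (R * S : ℝ) ^ 2 / n ^ 2 *
          ∑ p ∈ puncturedBox R with (n : ℤ) ∣ p.1 ∧ (n : ℤ) ∣ p.2, 1 / (pairNorm p : ℝ) ^ 2 := by
          rw [mul_sum]
          refine sum_congr rfl fun p hp => ?_
          have hp0 := (mem_puncturedBox.1 (mem_filter.1 hp).1).2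
          have hg : (0 : ℝ) < Int.gcd p.1 p.2 := by exact_mod_cast gcd_pos_of_ne_zero hp0
          have hpos : (0 : ℝ) < pairNorm p := by exact_mod_cast pairNorm_pos hp0
          have hn' : (0 : ℝ) < n := by exact_mod_cast hn
          field_simp
          ring
      _ ≤ 26244 * (R * S : ℝ) ^ 2 / n ^ 2 * (16 * harmonicSum R ^ 2 / n ^ 2) := by
          gcongr
          exact sum_puncturedBox_dvd_le R hn
      _ = _ := by
          have hn' : (0 : ℝ) < n := by exact_mod_cast hn
          field_simp
          ring

/-- Proportionality in the last column says that q divides det(p, s), so (S/g)^2 becomes S^2/(gq)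
and one factor g survives in the sum over p. -/
theorem card_le_of_proportional (h : IsShell G R S) (hS : 2 ≤ S) (hRS : R ≤ 2 * S) {q : ℕ}
    (hq : q.Prime) (hqS : q ≤ 2 * S) (hG : ∀ a ∈ G, OffDiagProportional q a) :
    (#G : ℝ) ≤ 419904 * (R * S) ^ 2 * harmonicSum R ^ 3 / q := by
  have hq0 : (0 : ℝ) < q := by exact_mod_cast hq.pos
  refine (h.card_le_sum hS one_pos (by simp) (by simp)
    (fun p => (6 * S : ℝ) ^ 2 / (Int.gcd p.1 p.2 * q)) fun p hp => ?_).trans ?_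
  · have hp0 := (mem_puncturedBox.1 hp).2
    have hg : (0 : ℝ) < Int.gcd p.1 p.2 := by exact_mod_cast gcd_pos_of_ne_zero hp0
    have := card_pairs_mul_le_of_det hp0 hq
      (((gcd_le_pairNorm hp0).trans (pairNorm_le_of_mem_puncturedBox hp)).trans hRS) hqS
      (fun z hz => (h.adjugate_image_bounds z hz).1) (fun z hz => (h.adjugate_image_bounds z hz).2)
      (fun z hz => by
        obtain ⟨a, ha, rfl⟩ := mem_image.1 hz
        obtain ⟨haG, rfl⟩ := mem_filter.1 ha
        exact hG a haG 0 1 2 (by decide) (by decide))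
    rw [le_div_iff₀ (by positivity), sq,
      show (6 * S : ℝ) * (6 * S) = 3 * (2 * S) * (3 * (2 * S)) by ring]
    exact_mod_cast this
  · calc ∑ p ∈ puncturedBox R with ((1 : ℕ) : ℤ) ∣ p.1 ∧ ((1 : ℕ) : ℤ) ∣ p.2,
          729 * ((R * Int.gcd p.1 p.2 : ℝ) / ((1 : ℕ) * pairNorm p)) ^ 2 *
            ((6 * S : ℝ) ^ 2 / (Int.gcd p.1 p.2 * q))
        = 26244 * (R * S : ℝ) ^ 2 / q *
          ∑ p ∈ puncturedBox R, (Int.gcd p.1 p.2 : ℝ) / (pairNorm p : ℝ) ^ 2 := by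
          rw [mul_sum, filter_true_of_mem (by simp)]
          refine sum_congr rfl fun p hp => ?_
          have hp0 := (mem_puncturedBox.1 hp).2
          have hg : (0 : ℝ) < Int.gcd p.1 p.2 := by exact_mod_cast gcd_pos_of_ne_zero hp0
          have hpos : (0 : ℝ) < pairNorm p := by exact_mod_cast pairNorm_pos hp0
          push_cast
          field_simp
          ring
      _ ≤ 26244 * (R * S : ℝ) ^ 2 / q * (16 * harmonicSum R ^ 3) := by
          gcongr
          exact sum_gcd_div_le R
      _ = _ := by
          field_simp
          ring

/-- For each of the q scalars, the off-diagonal p vanishes modulo q and any two matrices are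
congruent, so `card_le` applies with n = q. -/
theorem card_le_of_scalar (h : IsShell G R S) (hS : 2 ≤ S) (hRS : R ≤ 2 * S) {q : ℕ}
    [NeZero q]
    (hG : ∀ a ∈ G, ∃ c : ZMod q, a.map (Int.castRingHom (ZMod q)) = Matrix.scalar (Fin 3) c) :
    (#G : ℝ) ≤ q * (419904 * (R * S) ^ 2 * harmonicSum R ^ 2 / q ^ 4) := by
  have hsub : G ⊆ (univ : Finset (ZMod q)).biUnion fun c =>
      {a ∈ G | a.map (Int.castRingHom (ZMod q)) = Matrix.scalar (Fin 3) c} := by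
    intro a ha
    obtain ⟨c, hc⟩ := hG a ha
    exact mem_biUnion.2 ⟨c, mem_univ c, mem_filter.2 ⟨ha, hc⟩⟩
  have hcard : (#G : ℝ) ≤ ∑ c : ZMod q,
      (#{a ∈ G | a.map (Int.castRingHom (ZMod q)) = Matrix.scalar (Fin 3) c} : ℝ) := by
    exact_mod_cast (card_le_card hsub).trans card_biUnion_le
  refine hcard.trans ((sum_le_card_nsmul _ _
    (419904 * (R * S) ^ 2 * harmonicSum R ^ 2 / q ^ 4 : ℝ) fun c _ => ?_).trans ?_)
  · have hentry : ∀ a ∈ {a ∈ G | a.map (Int.castRingHom (ZMod q)) = Matrix.scalar (Fin 3) c},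
        ∀ i j, ((a i j : ℤ) : ZMod q) = if i = j then c else 0 := by
      intro a ha i j
      have := congrFun (congrFun (mem_filter.1 ha).2 i) j
      simpa [Matrix.diagonal_apply] using this
    refine (h.mono (filter_subset _ _)).card_le hS hRS (NeZero.pos q) (fun a ha => ?_)
      (fun a ha a' ha' i j => ?_)
    · simp only [← ZMod.intCast_zmod_eq_zero_iff_dvd, hentry a ha]
      exact ⟨if_neg (by decide), if_neg (by decide)⟩
    · rw [← ZMod.intCast_zmod_eq_zero_iff_dvd]
      push_cast
      rw [hentry a ha, hentry a' ha', sub_self]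
  · rw [card_univ, ZMod.card, nsmul_eq_mul]

end IsShell

end MatrixCounting

/-! ### Dyadic decomposition by the size of the inverse -/

section DyadicDecomposition

open Finset

/-- The maximum of the absolute values of the entries, as a natural number. -/
def maxEntry (a : Matrix (Fin 3) (Fin 3) ℤ) : ℕ :=
  (univ : Finset (Fin 3 × Fin 3)).sup fun z => (a z.1 z.2).natAbs

theorem natAbs_le_maxEntry (a : Matrix (Fin 3) (Fin 3) ℤ) (i j : Fin 3) :
    (a i j).natAbs ≤ maxEntry a :=
  le_sup (f := fun z : Fin 3 × Fin 3 => (a z.1 z.2).natAbs) (mem_univ (i, j))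

theorem abs_le_of_maxEntry_le {a : Matrix (Fin 3) (Fin 3) ℤ} {n : ℕ} (h : maxEntry a ≤ n)
    (i j : Fin 3) : |a i j| ≤ (n : ℤ) := by
  rw [Int.abs_eq_natAbs]
  exact_mod_cast (natAbs_le_maxEntry a i j).trans h

theorem exists_natAbs_eq_maxEntry (a : Matrix (Fin 3) (Fin 3) ℤ) :
    ∃ j i, (a i j).natAbs = maxEntry a := by
  obtain ⟨z, -, hz⟩ := exists_mem_eq_sup (univ : Finset (Fin 3 × Fin 3)) univ_nonempty
    fun z => (a z.1 z.2).natAbs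
  exact ⟨z.2, z.1, hz.symm⟩

theorem entryNorm_eq_maxEntry (a : Matrix (Fin 3) (Fin 3) ℤ) : entryNorm a = maxEntry a := by
  have h0 : 0 ≤ entryNorm a := by
    let : NormedAddCommGroup (Matrix (Fin 3) (Fin 3) ℤ) := Matrix.normedAddCommGroup
    exact norm_nonneg a
  refine le_antisymm ((entryNorm_le_iff a (by positivity)).2 fun i j => ?_) ?_
  · rw [← Int.cast_abs, Int.abs_eq_natAbs, Int.cast_natCast]
    exact_mod_cast natAbs_le_maxEntry a i j
  · obtain ⟨j, i, h⟩ := exists_natAbs_eq_maxEntry a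
    have := (entryNorm_le_iff a h0).1 le_rfl i j
    rwa [← Int.cast_abs, Int.abs_eq_natAbs, Int.cast_natCast, h] at this

theorem maxEntry_pos {a : Matrix (Fin 3) (Fin 3) ℤ} (h : a.det = 1) : 0 < maxEntry a := by
  by_contra! h0
  have : a = 0 := by
    ext i j
    have := natAbs_le_maxEntry a i j
    simp
    omega
  rw [this, Matrix.det_zero] at h
  exact zero_ne_one h

theorem det_adjugate_eq_one {a : Matrix (Fin 3) (Fin 3) ℤ} (h : a.det = 1) :
    a.adjugate.det = 1 := by
  rw [Matrix.det_adjugate, h, one_pow]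

theorem card_le_pow_of_maxEntry_le {G : Finset (Matrix (Fin 3) (Fin 3) ℤ)} {n : ℕ}
    (h : ∀ a ∈ G, maxEntry a ≤ n) : #G ≤ (2 * n + 1) ^ 9 := by
  have hsub : G ⊆ Fintype.piFinset fun _ : Fin 3 =>
      Fintype.piFinset fun _ : Fin 3 => Icc (-n : ℤ) n := by
    intro a ha
    refine Fintype.mem_piFinset.2 fun i => Fintype.mem_piFinset.2 fun j => mem_Icc.2 ?_
    exact abs_le.1 (abs_le_of_maxEntry_le (h a ha) i j)
  have hcard : #(Icc (-n : ℤ) n) = 2 * n + 1 := by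
    rw [Int.card_Icc]
    omega
  refine (card_le_card hsub).trans (le_of_eq ((Fintype.card_piFinset _).trans ?_))
  simp only [Fintype.card_piFinset, prod_const, card_univ, Fintype.card_fin, hcard]
  rw [← pow_mul]

/-- The simultaneous cyclic shift of rows and columns by `c`. -/
def cyclicShift (c : Fin 3) (a : Matrix (Fin 3) (Fin 3) ℤ) : Matrix (Fin 3) (Fin 3) ℤ :=
  a.submatrix (Equiv.addRight c) (Equiv.addRight c)

theorem cyclicShift_apply (c i j : Fin 3) (a : Matrix (Fin 3) (Fin 3) ℤ) :
    cyclicShift c a i j = a (i + c) (j + c) := rfl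

theorem adjugate_cyclicShift (c : Fin 3) (a : Matrix (Fin 3) (Fin 3) ℤ) :
    (cyclicShift c a).adjugate = cyclicShift c a.adjugate :=
  Matrix.adjugate_submatrix_equiv_self _ _

theorem det_cyclicShift (c : Fin 3) (a : Matrix (Fin 3) (Fin 3) ℤ) :
    (cyclicShift c a).det = a.det :=
  Matrix.det_submatrix_equiv_self _ _

theorem cyclicShift_injective (c : Fin 3) : Function.Injective (cyclicShift c) := by
  intro a b h
  ext i j
  simpa [cyclicShift_apply] using congrFun (congrFun h (i - c)) (j - c)

theorem isShell_image_cyclicShift {G : Finset (Matrix (Fin 3) (Fin 3) ℤ)} {R S : ℕ} (j : Fin 3)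
    (hdet : ∀ a ∈ G, a.det = 1) (hR : ∀ a ∈ G, maxEntry a ≤ R)
    (hS : ∀ a ∈ G, S ≤ maxEntry a.adjugate ∧ maxEntry a.adjugate ≤ 2 * S)
    (hj : ∀ a ∈ G, ∃ i, (a.adjugate i j).natAbs = maxEntry a.adjugate) :
    IsShell (G.image (cyclicShift (j - 2))) R S := by
  refine ⟨?_, ?_, ?_, ?_⟩ <;> intro b hb <;> obtain ⟨a, ha, rfl⟩ := mem_image.1 hb
  · rw [det_cyclicShift, hdet a ha]
  · intro i k
    exact abs_le_of_maxEntry_le (hR a ha) _ _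
  · intro i k
    rw [adjugate_cyclicShift]
    exact_mod_cast abs_le_of_maxEntry_le (hS a ha).2 (i + (j - 2)) (k + (j - 2))
  · obtain ⟨i, hi⟩ := hj a ha
    refine ⟨i - (j - 2), ?_⟩
    rw [adjugate_cyclicShift, cyclicShift_apply, sub_add_cancel, add_sub_cancel]
    rw [Int.abs_eq_natAbs, hi]
    exact_mod_cast (hS a ha).1

/-- Sort by the dyadic size 2^k of the inverse and by a column j holding its largest entry; the
cyclic shift moves j to the last column. It acts equally on rows and columns so that properties such
as being scalar modulo q survive. -/
theorem card_le_of_forall_isShell {P : Matrix (Fin 3) (Fin 3) ℤ → Prop}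
    (hP : ∀ c a, P a → P (cyclicShift c a)) {N m : ℕ} {W : ℝ} (hW0 : 0 ≤ W)
    (hW : ∀ (G : Finset (Matrix (Fin 3) (Fin 3) ℤ)) (R S : ℕ), IsShell G R S → (∀ a ∈ G, P a) →
      2 ≤ S → R ≤ 2 * S → R * S ≤ N → m ≤ 2 * S → (#G : ℝ) ≤ W)
    {G : Finset (Matrix (Fin 3) (Fin 3) ℤ)} (hdet : ∀ a ∈ G, a.det = 1)
    (hle : ∀ a ∈ G, maxEntry a ≤ maxEntry a.adjugate)
    (hN : ∀ a ∈ G, maxEntry a * maxEntry a.adjugate ≤ N)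
    (hm : ∀ a ∈ G, m ≤ maxEntry a.adjugate) (hG : ∀ a ∈ G, P a) :
    (#G : ℝ) ≤ 19683 + 3 * Nat.log 2 N * W := by
  let shell : ℕ → Fin 3 → Finset (Matrix (Fin 3) (Fin 3) ℤ) := fun k j =>
    {a ∈ G | (2 ^ k ≤ maxEntry a.adjugate ∧ maxEntry a.adjugate < 2 ^ (k + 1)) ∧
      ∃ i, (a.adjugate i j).natAbs = maxEntry a.adjugate}
  have hshell : ∀ k, 1 ≤ k → ∀ j, (#(shell k j) : ℝ) ≤ W := by
    intro k hk j
    have mem : ∀ a ∈ shell k j, a ∈ G ∧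
      (2 ^ k ≤ maxEntry a.adjugate ∧ maxEntry a.adjugate < 2 ^ (k + 1)) ∧
      ∃ i, (a.adjugate i j).natAbs = maxEntry a.adjugate := fun a ha => mem_filter.1 ha
    rcases (shell k j).eq_empty_or_nonempty with h0 | ⟨a₀, ha₀⟩
    · rw [h0]
      simpa using hW0
    have hS : 2 ≤ 2 ^ k := Nat.le_self_pow (by omega) 2
    have hpow : 2 ^ (k + 1) = 2 * 2 ^ k := by ring
    rw [← card_image_of_injective _ (cyclicShift_injective (j - 2))]
    -- The first bound makes R·S ≤ N, the second records ‖a‖ ≤ ‖a⁻¹‖ as R ≤ 2S.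
    refine hW _ (min (N / 2 ^ k) (2 * 2 ^ k)) (2 ^ k) (isShell_image_cyclicShift j ?_ ?_ ?_ ?_) ?_
      hS (min_le_right _ _) ?_ ?_
    · exact fun a ha => hdet a (mem a ha).1
    · intro a ha
      obtain ⟨haG, ⟨h1, h2⟩, -⟩ := mem a ha
      refine le_min ((Nat.le_div_iff_mul_le (by positivity)).2 ?_) ?_
      · exact (Nat.mul_le_mul_left _ h1).trans (hN a haG)
      · have := hle a haG
        omega
    · intro a ha
      obtain ⟨haG, ⟨h1, h2⟩, -⟩ := mem a ha
      exact ⟨h1, by omega⟩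
    · exact fun a ha => (mem a ha).2.2
    · intro b hb
      obtain ⟨a, ha, rfl⟩ := mem_image.1 hb
      exact hP _ a (hG a (mem a ha).1)
    · exact (Nat.mul_le_mul_right _ (min_le_left _ _)).trans (Nat.div_mul_le_self _ _)
    -- The bound m ≤ 2S is read off an element, which is why empty shells were set aside.
    · obtain ⟨haG, ⟨h1, h2⟩, -⟩ := mem a₀ ha₀
      have := hm a₀ haG
      omega
  have hsub : G ⊆ {a ∈ G | maxEntry a ≤ 1} ∪ (Icc 1 (Nat.log 2 N) ×ˢ univ).biUnion
      fun z => shell z.1 z.2 := by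
    intro a ha
    by_cases h1 : maxEntry a.adjugate ≤ 1
    · exact mem_union_left _ (mem_filter.2 ⟨ha, (hle a ha).trans h1⟩)
    · obtain ⟨j, hj⟩ := exists_natAbs_eq_maxEntry a.adjugate
      have hne : maxEntry a.adjugate ≠ 0 := by omega
      have hbN : maxEntry a.adjugate ≤ N :=
        (Nat.le_mul_of_pos_left _ (maxEntry_pos (hdet a ha))).trans (hN a ha)
      refine mem_union_right _ (mem_biUnion.2 ⟨(Nat.log 2 (maxEntry a.adjugate), j), ?_, ?_⟩)
      · refine mem_product.2 ⟨mem_Icc.2 ⟨Nat.log_pos one_lt_two (by omega),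
          Nat.log_mono_right (b := 2) hbN⟩, mem_univ _⟩
      · exact mem_filter.2 ⟨ha, ⟨Nat.pow_log_le_self 2 hne,
          Nat.lt_pow_succ_log_self one_lt_two _⟩, hj⟩
  -- Here 19683 = 3^9: nine entries in {-1, 0, 1}.
  have hsmall : #{a ∈ G | maxEntry a ≤ 1} ≤ 19683 :=
    card_le_pow_of_maxEntry_le (n := 1) fun a ha => (mem_filter.1 ha).2
  calc (#G : ℝ) ≤ #{a ∈ G | maxEntry a ≤ 1} +
        ∑ z ∈ Icc 1 (Nat.log 2 N) ×ˢ (univ : Finset (Fin 3)), (#(shell z.1 z.2) : ℝ) := by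
        exact_mod_cast ((card_le_card hsub).trans (card_union_le _ _)).trans
          (Nat.add_le_add_left card_biUnion_le _)
    _ ≤ 19683 + ∑ z ∈ Icc 1 (Nat.log 2 N) ×ˢ (univ : Finset (Fin 3)), W := by
        gcongr with z hz
        · exact_mod_cast hsmall
        · exact hshell z.1 (mem_Icc.1 (mem_product.1 hz).1).1 z.2
    _ = 19683 + 3 * Nat.log 2 N * W := by
        rw [sum_const, card_product, Nat.card_Icc, Nat.add_sub_cancel, card_univ, Fintype.card_fin,
          nsmul_eq_mul]
        push_cast
        ring

theorem offDiagProportional_cyclicShift {q : ℕ} (c : Fin 3) (a : Matrix (Fin 3) (Fin 3) ℤ)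
    (h : OffDiagProportional q a) : OffDiagProportional q (cyclicShift c a) := by
  intro i k j hi hk
  rw [adjugate_cyclicShift]
  exact h _ _ _ (by simpa using hi) (by simpa using hk)

theorem scalar_cyclicShift {q : ℕ} (c : Fin 3) (a : Matrix (Fin 3) (Fin 3) ℤ)
    (h : ∃ d : ZMod q, a.map (Int.castRingHom (ZMod q)) = Matrix.scalar (Fin 3) d) :
    ∃ d : ZMod q, (cyclicShift c a).map (Int.castRingHom (ZMod q)) = Matrix.scalar (Fin 3) d := by
  obtain ⟨d, hd⟩ := h
  refine ⟨d, ?_⟩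
  ext i j
  have := congrFun (congrFun hd (i + c)) (j + c)
  simpa [cyclicShift_apply, Matrix.diagonal_apply] using this

theorem harmonicSum_mono {m n : ℕ} (h : m ≤ n) : harmonicSum m ≤ harmonicSum n :=
  sum_le_sum_of_subset_of_nonneg (range_mono (by omega)) fun _ _ _ => by positivity

section Classes

variable {N : ℕ} {G : Finset (Matrix (Fin 3) (Fin 3) ℤ)}

theorem card_le_of_maxEntry_mul_le (hdet : ∀ a ∈ G, a.det = 1)
    (hle : ∀ a ∈ G, maxEntry a ≤ maxEntry a.adjugate)
    (hN : ∀ a ∈ G, maxEntry a * maxEntry a.adjugate ≤ N) :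
    (#G : ℝ) ≤ 19683 + 3 * Nat.log 2 N * (419904 * N ^ 2 * harmonicSum N ^ 2) := by
  refine card_le_of_forall_isShell (P := fun _ => True) (m := 0) (fun _ _ _ => trivial)
    (by positivity) ?_ hdet hle hN (fun _ _ => Nat.zero_le _) (fun _ _ => trivial)
  intro G R S h _ hS hRS hN _
  refine (h.card_le hS hRS one_pos (by simp) (by simp)).trans ?_
  have h1 : (R * S : ℝ) ≤ N := by exact_mod_cast hN
  have h2 := harmonicSum_mono ((Nat.le_mul_of_pos_right R (by omega : 0 < S)).trans hN)
  have h3 := one_le_harmonicSum R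
  rw [Nat.cast_one, one_pow, div_one]
  gcongr

theorem card_le_of_proportional (hdet : ∀ a ∈ G, a.det = 1)
    (hle : ∀ a ∈ G, maxEntry a ≤ maxEntry a.adjugate)
    (hN : ∀ a ∈ G, maxEntry a * maxEntry a.adjugate ≤ N) {q : ℕ} (hq : q.Prime)
    (hqG : ∀ a ∈ G, q ≤ maxEntry a.adjugate) (hG : ∀ a ∈ G, OffDiagProportional q a) :
    (#G : ℝ) ≤ 19683 + 3 * Nat.log 2 N * (419904 * N ^ 2 * harmonicSum N ^ 3 / q) := by
  have h0 := one_le_harmonicSum N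
  refine card_le_of_forall_isShell (P := OffDiagProportional q) (m := q)
    offDiagProportional_cyclicShift (by positivity) ?_ hdet hle hN hqG hG
  intro G R S h hG hS hRS hN hqS
  refine (h.card_le_of_proportional hS hRS hq hqS hG).trans ?_
  have h1 : (R * S : ℝ) ≤ N := by exact_mod_cast hN
  have h2 := harmonicSum_mono ((Nat.le_mul_of_pos_right R (by omega : 0 < S)).trans hN)
  have h3 := one_le_harmonicSum R
  gcongr

theorem card_le_of_scalar (hdet : ∀ a ∈ G, a.det = 1)
    (hle : ∀ a ∈ G, maxEntry a ≤ maxEntry a.adjugate)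
    (hN : ∀ a ∈ G, maxEntry a * maxEntry a.adjugate ≤ N) {q : ℕ} [NeZero q]
    (hG : ∀ a ∈ G, ∃ c : ZMod q, a.map (Int.castRingHom (ZMod q)) = Matrix.scalar (Fin 3) c) :
    (#G : ℝ) ≤ 19683 + 3 * Nat.log 2 N * (q * (419904 * N ^ 2 * harmonicSum N ^ 2 / q ^ 4)) := by
  refine card_le_of_forall_isShell (m := 0) scalar_cyclicShift (by positivity) ?_ hdet hle hN
    (fun _ _ => Nat.zero_le _) hG
  intro G R S h hG hS hRS hN _
  refine (h.card_le_of_scalar hS hRS hG).trans ?_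
  have h1 : (R * S : ℝ) ≤ N := by exact_mod_cast hN
  have h2 := harmonicSum_mono ((Nat.le_mul_of_pos_right R (by omega : 0 < S)).trans hN)
  have h3 := one_le_harmonicSum R
  gcongr

end Classes

end DyadicDecomposition

/-! ### Logarithms, inversion and summation of the three regimes -/

section Assembly

open Finset

/-- A bound for the harmonic sums and binary logarithms of the natural numbers up to `q ^ 3`. -/
noncomputable def logBound (q : ℕ) : ℝ := 2 + 6 * Real.log q

theorem one_le_logBound {q : ℕ} (hq : 0 < q) : 1 ≤ logBound q := by
  have := Real.log_nonneg (show (1 : ℝ) ≤ q by exact_mod_cast hq)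
  rw [logBound]
  linarith

theorem harmonicSum_le_logBound {q n : ℕ} (hq : 0 < q) (hn : n ≤ q ^ 3) :
    harmonicSum n ≤ logBound q := by
  have hq1 : (1 : ℝ) ≤ q := by exact_mod_cast hq
  have h1 : harmonicSum n = (harmonic (n + 1) : ℝ) := by
    rw [harmonicSum, harmonic]
    push_cast
    simp only [one_div]
  have h2 : ((n + 1 : ℕ) : ℝ) ≤ 2 * (q : ℝ) ^ 3 := by
    have : n + 1 ≤ 2 * q ^ 3 := by
      have := Nat.pow_pos (n := 3) hq
      omega
    exact_mod_cast this
  have h3 := harmonic_le_one_add_log (n + 1)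
  have h4 := Real.log_le_log (by positivity) h2
  rw [Real.log_mul (by norm_num) (by positivity), Real.log_pow] at h4
  have h5 := Real.log_two_lt_d9
  have h6 := Real.log_nonneg hq1
  rw [h1, logBound]
  push_cast at *
  linarith

theorem natLog_le_logBound {q n : ℕ} (hq : 0 < q) (hn0 : 0 < n) (hn : n ≤ q ^ 3) :
    (Nat.log 2 n : ℝ) ≤ logBound q := by
  have hq1 : (1 : ℝ) ≤ q := by exact_mod_cast hq
  have h1 : ((2 ^ Nat.log 2 n : ℕ) : ℝ) ≤ (q : ℝ) ^ 3 := by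
    exact_mod_cast (Nat.pow_log_le_self 2 hn0.ne').trans hn
  push_cast at h1
  have h2 := Real.log_le_log (by positivity) h1
  rw [Real.log_pow, Real.log_pow] at h2
  have h3 := Real.log_two_gt_d9
  have h4 := Real.log_nonneg hq1
  have h5 : (0 : ℝ) ≤ Nat.log 2 n := by positivity
  rw [logBound]
  push_cast at h2
  nlinarith

theorem logBound_pow_le {ε : ℝ} (hε : 0 < ε) {q : ℕ} (hq : 0 < q) :
    logBound q ^ 4 ≤ (2 + 24 / ε) ^ 4 * (q : ℝ) ^ ε := by
  have hq1 : (1 : ℝ) ≤ q := by exact_mod_cast hq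
  -- The exponent ε/4 is chosen so that the fourth power costs exactly q^ε.
  have h1 := Real.log_le_rpow_div (x := q) (by positivity) (show 0 < ε / 4 by positivity)
  have h2 : (1 : ℝ) ≤ (q : ℝ) ^ (ε / 4) := Real.one_le_rpow hq1 (by positivity)
  have h3 : logBound q ≤ (2 + 24 / ε) * (q : ℝ) ^ (ε / 4) := by
    have : (q : ℝ) ^ (ε / 4) / (ε / 4) = 4 / ε * (q : ℝ) ^ (ε / 4) := by
      field_simp
    rw [this] at h1
    calc logBound q ≤ 2 * (q : ℝ) ^ (ε / 4) + 6 * (4 / ε * (q : ℝ) ^ (ε / 4)) := by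
          rw [logBound]
          linarith
      _ = _ := by ring
  have h0 := one_le_logBound hq
  calc logBound q ^ 4 ≤ ((2 + 24 / ε) * (q : ℝ) ^ (ε / 4)) ^ 4 := by gcongr
    _ = (2 + 24 / ε) ^ 4 * (q : ℝ) ^ ε := by
      rw [mul_pow, ← Real.rpow_mul_natCast (by positivity)]
      congr 2
      push_cast
      ring

/-- The elements of `SL₃(ℤ)` with `‖γ‖ ‖γ⁻¹‖ ≤ N`. -/
def boundedElements (N : ℕ) : Set SL(3, ℤ) :=
  {γ | maxEntry γ * maxEntry (γ : Matrix (Fin 3) (Fin 3) ℤ).adjugate ≤ N}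

theorem boundedElements_finite (N : ℕ) : (boundedElements N).Finite := by
  refine Set.Finite.of_injOn (f := fun γ : SL(3, ℤ) => (γ : Matrix (Fin 3) (Fin 3) ℤ))
    (t := ((Fintype.piFinset fun _ : Fin 3 => Fintype.piFinset fun _ : Fin 3 =>
      Icc (-N : ℤ) N : Finset (Fin 3 → Fin 3 → ℤ)) : Set (Fin 3 → Fin 3 → ℤ))) ?_
      Subtype.val_injective.injOn (Finset.finite_toSet _)
  intro γ hγ
  have h1 := maxEntry_pos (det_adjugate_eq_one γ.det_coe)
  have h2 : maxEntry γ ≤ N := (Nat.le_mul_of_pos_right _ h1).trans hγ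
  refine mem_coe.2 (Fintype.mem_piFinset.2 fun i => Fintype.mem_piFinset.2 fun j => mem_Icc.2 ?_)
  exact abs_le.1 (abs_le_of_maxEntry_le h2 i j)

theorem inv_mem_boundedElements {N : ℕ} {γ : SL(3, ℤ)} (h : γ ∈ boundedElements N) :
    γ⁻¹ ∈ boundedElements N := by
  simp only [boundedElements, Set.mem_ofPred_eq, ← Matrix.SpecialLinearGroup.coe_inv] at h ⊢
  rwa [inv_inv, mul_comm]

theorem mem_boundedElements_iff {T : ℝ} (hT : 0 ≤ T) (γ : SL(3, ℤ)) :
    γ ∈ boundedElements ⌊T⌋₊ ↔ entryNorm (γ : Matrix (Fin 3) (Fin 3) ℤ) *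
        entryNorm ((γ⁻¹ : SL(3, ℤ)) : Matrix (Fin 3) (Fin 3) ℤ) ≤ T := by
  rw [entryNorm_eq_maxEntry, entryNorm_eq_maxEntry, Matrix.SpecialLinearGroup.coe_inv,
    boundedElements, Set.mem_ofPred_eq, Nat.le_floor_iff hT]
  push_cast
  rfl

variable {q : ℕ} [hq : Fact q.Prime]

theorem fixedFlagPairs_eq {T : ℝ} (hT : 0 ≤ T) : fixedFlagPairs q T =
    ⋃ γ ∈ (boundedElements_finite ⌊T⌋₊).toFinset,
      Prod.mk γ '' {x : CompleteFlag (ZMod q) | flagAction q γ x = x} := by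
  ext ⟨γ, x⟩
  simp [fixedFlagPairs, mem_boundedElements_iff hT, and_comm]

theorem finite_fixedFlagPairs {T : ℝ} (hT : 0 ≤ T) : (fixedFlagPairs q T).Finite := by
  rw [fixedFlagPairs_eq hT]
  exact Set.Finite.biUnion (Finset.finite_toSet _) fun γ _ => Set.toFinite _

theorem ncard_fixedFlagPairs_le {T : ℝ} (hT : 0 ≤ T) : (fixedFlagPairs q T).ncard ≤
    ∑ γ ∈ (boundedElements_finite ⌊T⌋₊).toFinset, fixedFlagCount q γ := by
  rw [fixedFlagPairs_eq hT]
  refine (Finset.set_ncard_biUnion_le _ _).trans (le_of_eq (sum_congr rfl fun γ _ => ?_))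
  rw [Set.ncard_image_of_injective _ (Prod.mk_right_injective γ), fixedFlagCount]

/-- The elements of `boundedElements N` with `‖γ‖ ≤ ‖γ⁻¹‖`. -/
noncomputable def halfElements (N : ℕ) : Finset SL(3, ℤ) :=
  {γ ∈ (boundedElements_finite N).toFinset |
    maxEntry γ ≤ maxEntry (γ : Matrix (Fin 3) (Fin 3) ℤ).adjugate}

theorem mem_halfElements {N : ℕ} {γ : SL(3, ℤ)} : γ ∈ halfElements N ↔
    maxEntry γ * maxEntry (γ : Matrix (Fin 3) (Fin 3) ℤ).adjugate ≤ N ∧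
      maxEntry γ ≤ maxEntry (γ : Matrix (Fin 3) (Fin 3) ℤ).adjugate := by
  rw [halfElements, mem_filter, Set.Finite.mem_toFinset]
  rfl

/-- Inversion preserves both the ball and the number of fixed flags, and maps elements with ‖γ‖ ≥
‖γ⁻¹‖ into the half considered. -/
theorem sum_boundedElements_le (N : ℕ) :
    ∑ γ ∈ (boundedElements_finite N).toFinset, fixedFlagCount q γ ≤
      2 * ∑ γ ∈ halfElements N, fixedFlagCount q γ := by
  classical
  have hsub : (boundedElements_finite N).toFinset ⊆
      halfElements N ∪ (halfElements N).image fun γ => γ⁻¹ := by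
    intro γ hγ
    have hγ' := (Set.Finite.mem_toFinset _).1 hγ
    rcases le_total (maxEntry γ) (maxEntry (γ : Matrix (Fin 3) (Fin 3) ℤ).adjugate) with h | h
    · exact mem_union_left _ (mem_halfElements.2 ⟨hγ', h⟩)
    · refine mem_union_right _ (mem_image.2 ⟨γ⁻¹, mem_halfElements.2
        ⟨inv_mem_boundedElements hγ', ?_⟩, inv_inv γ⟩)
      rwa [← Matrix.SpecialLinearGroup.coe_inv, inv_inv, Matrix.SpecialLinearGroup.coe_inv]
  refine (sum_le_sum_of_subset hsub).trans ?_
  have h1 := sum_union_inter (s₁ := halfElements N) (s₂ := (halfElements N).image fun γ => γ⁻¹)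
    (f := fixedFlagCount q)
  rw [sum_image inv_injective.injOn] at h1
  simp only [fixedFlagCount_inv] at h1
  omega

/-- The underlying integer matrices of a finite set of elements of `SL₃(ℤ)`. -/
noncomputable def coeImage (Γ : Finset SL(3, ℤ)) : Finset (Matrix (Fin 3) (Fin 3) ℤ) :=
  Γ.map ⟨fun γ : SL(3, ℤ) => (γ : Matrix (Fin 3) (Fin 3) ℤ), Subtype.val_injective⟩

open Classical in
theorem sum_halfElements_le (N : ℕ) : ∑ γ ∈ halfElements N, fixedFlagCount q γ ≤
    36 * #(halfElements N) +
    72 * q * #((halfElements N).filter fun γ : SL(3, ℤ) => OffDiagProportional q γ) +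
    4 * q ^ 3 * #((halfElements N).filter fun γ : SL(3, ℤ) => ∃ c : ZMod q,
      (γ : Matrix (Fin 3) (Fin 3) ℤ).map (Int.castRingHom (ZMod q)) = Matrix.scalar (Fin 3) c) := by
  rw [card_eq_sum_ones, card_filter, card_filter, mul_sum, mul_sum, mul_sum, ← sum_add_distrib,
    ← sum_add_distrib]
  refine sum_le_sum fun γ _ => ?_
  by_cases h1 : ∃ c : ZMod q, (γ : Matrix (Fin 3) (Fin 3) ℤ).map (Int.castRingHom (ZMod q)) =
        Matrix.scalar (Fin 3) c
  · rw [if_pos h1]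
    have := fixedFlagCount_le (q := q) γ
    omega
  · by_cases h2 : OffDiagProportional q (γ : Matrix (Fin 3) (Fin 3) ℤ)
    · rw [if_pos h2]
      have := fixedFlagCount_le_of_not_scalar (q := q) γ (not_exists.1 h1)
      omega
    · have := fixedFlagCount_le_of_not_proportional (q := q) γ h2
      omega

theorem mem_coeImage {Γ : Finset SL(3, ℤ)} {P : Matrix (Fin 3) (Fin 3) ℤ → Prop}
    (h : ∀ γ : SL(3, ℤ), γ ∈ Γ → P (γ : Matrix (Fin 3) (Fin 3) ℤ)) : ∀ a ∈ coeImage Γ, P a := by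
  intro a ha
  obtain ⟨γ, hγ, rfl⟩ := mem_map.1 ha
  exact h γ hγ

theorem det_of_mem_coeImage {Γ : Finset SL(3, ℤ)} : ∀ a ∈ coeImage Γ, a.det = 1 :=
  mem_coeImage fun γ _ => γ.det_coe

/-- The constant is 19683 + 3·419904. Only three logarithms occur here, one dyadic and two harmonic;
the fourth is padding, to match the proportional case. -/
theorem card_halfElements_le {N : ℕ} (hN0 : 0 < N) (hN : N ≤ q ^ 3) :
    (#(halfElements N) : ℝ) ≤ 1279395 * logBound q ^ 4 * N ^ 2 := by
  have h := card_le_of_maxEntry_mul_le (N := N) (det_of_mem_coeImage (Γ := halfElements N))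
    (mem_coeImage fun γ hγ => (mem_halfElements.1 hγ).2)
    (mem_coeImage fun γ hγ => (mem_halfElements.1 hγ).1)
  rw [coeImage, card_map] at h
  refine h.trans ?_
  have h1 := one_le_logBound hq.out.pos
  have h2 := harmonicSum_le_logBound hq.out.pos hN
  have h3 := natLog_le_logBound hq.out.pos hN0 hN
  have h4 := one_le_harmonicSum N
  have h5 : (1 : ℝ) ≤ N := by exact_mod_cast hN0
  calc 19683 + 3 * (Nat.log 2 N : ℝ) * (419904 * N ^ 2 * harmonicSum N ^ 2)
      ≤ 19683 * (logBound q ^ 4 * (N : ℝ) ^ 2) +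
        3 * logBound q * (419904 * N ^ 2 * logBound q ^ 2) * logBound q := by
        refine add_le_add (le_mul_of_one_le_right (by norm_num) ?_)
          (le_trans ?_ (le_mul_of_one_le_right (by positivity) h1))
        · exact one_le_mul_of_one_le_of_one_le (one_le_pow₀ h1) (one_le_pow₀ h5)
        · gcongr
    _ = _ := by ring

-- If ‖γ⁻¹‖ < q, then ‖γ‖‖γ⁻¹‖ ≤ q^2 and the count for the whole ball of size min(N, q^2) suffices.
-- Otherwise the congruence on s is effective and gives N^2/q ≤ N q^2.
open Classical in
theorem card_proportional_le {N : ℕ} (hN0 : 0 < N) (hN : N ≤ q ^ 3) :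
    (#((halfElements N).filter fun γ : SL(3, ℤ) => OffDiagProportional q γ) : ℝ) ≤
      2 * (1279395 * logBound q ^ 4 * (N * q ^ 2)) := by
  set Γ : Finset SL(3, ℤ) := (halfElements N).filter fun γ : SL(3, ℤ) =>
    OffDiagProportional q γ ∧ q ≤ maxEntry (γ : Matrix (Fin 3) (Fin 3) ℤ).adjugate
  have hqpos := hq.out.pos
  have hq1 : (1 : ℝ) ≤ q := by exact_mod_cast hqpos
  have hq0 : (0 : ℝ) < q := by positivity
  have h5 : (1 : ℝ) ≤ N := by exact_mod_cast hN0
  have h1 := one_le_logBound hqpos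
  have hsub : ((halfElements N).filter fun γ : SL(3, ℤ) => OffDiagProportional q γ) ⊆
      halfElements (min N (q ^ 2)) ∪ Γ := by
    intro γ hγ
    obtain ⟨hγ1, hγ2⟩ := mem_filter.1 hγ
    by_cases h : q ≤ maxEntry (γ : Matrix (Fin 3) (Fin 3) ℤ).adjugate
    · exact mem_union_right _ (mem_filter.2 ⟨hγ1, hγ2, h⟩)
    · rw [mem_halfElements] at hγ1
      refine mem_union_left _ (mem_halfElements.2 ⟨le_min hγ1.1 ?_, hγ1.2⟩)
      rw [sq]
      exact Nat.mul_le_mul (by omega) (by omega)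
  have hA : (#(halfElements (min N (q ^ 2))) : ℝ) ≤
      1279395 * logBound q ^ 4 * (N * q ^ 2) := by
    refine (card_halfElements_le (q := q) (lt_min hN0 (by positivity))
      ((min_le_left _ _).trans hN)).trans ?_
    rw [sq ((min N (q ^ 2) : ℕ) : ℝ)]
    have e1 : ((min N (q ^ 2) : ℕ) : ℝ) ≤ N := by exact_mod_cast min_le_left _ _
    have e2 : ((min N (q ^ 2) : ℕ) : ℝ) ≤ q ^ 2 := by exact_mod_cast min_le_right N (q ^ 2)
    gcongr
  have hB : (#Γ : ℝ) ≤ 1279395 * logBound q ^ 4 * (N * q ^ 2) := by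
    have h := card_le_of_proportional (N := N) (det_of_mem_coeImage (Γ := Γ))
      (mem_coeImage fun γ hγ => (mem_halfElements.1 (mem_filter.1 hγ).1).2)
      (mem_coeImage fun γ hγ => (mem_halfElements.1 (mem_filter.1 hγ).1).1) hq.out
      (mem_coeImage fun γ hγ => (mem_filter.1 hγ).2.2)
      (mem_coeImage fun γ hγ => (mem_filter.1 hγ).2.1)
    rw [coeImage, card_map] at h
    refine h.trans ?_
    have h2 := harmonicSum_le_logBound hqpos hN
    have h3 := natLog_le_logBound hqpos hN0 hN
    have h4 := one_le_harmonicSum N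
    have h6 : (N : ℝ) ^ 2 / q ≤ N * q ^ 2 := by
      have : (N : ℝ) ≤ q ^ 3 := by exact_mod_cast hN
      rw [div_le_iff₀ hq0, sq, mul_assoc, ← pow_succ]
      gcongr
    calc 19683 + 3 * (Nat.log 2 N : ℝ) * (419904 * N ^ 2 * harmonicSum N ^ 3 / q)
        = 19683 + 3 * (Nat.log 2 N : ℝ) * (419904 * (N ^ 2 / q) * harmonicSum N ^ 3) := by ring
      _ ≤ 19683 * (logBound q ^ 4 * (N * q ^ 2)) +
          3 * logBound q * (419904 * (N * q ^ 2) * logBound q ^ 3) := by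
          refine add_le_add (le_mul_of_one_le_right (by norm_num) ?_) ?_
          · exact one_le_mul_of_one_le_of_one_le (one_le_pow₀ h1)
              (one_le_mul_of_one_le_of_one_le h5 (one_le_pow₀ hq1))
          · gcongr
      _ = _ := by ring
  have hcard := (card_le_card hsub).trans (card_union_le _ _)
  have hcard' : (#((halfElements N).filter fun γ : SL(3, ℤ) =>
      OffDiagProportional q γ) : ℝ) ≤ #(halfElements (min N (q ^ 2))) + #Γ := by
    exact_mod_cast hcard
  linarith

open Classical in
theorem card_scalar_le {N : ℕ} (hN0 : 0 < N) (hN : N ≤ q ^ 3) :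
    (#((halfElements N).filter fun γ : SL(3, ℤ) => ∃ c : ZMod q,
      (γ : Matrix (Fin 3) (Fin 3) ℤ).map (Int.castRingHom (ZMod q)) = Matrix.scalar (Fin 3) c) : ℝ) ≤
        1279395 * logBound q ^ 4 * N := by
  have hqpos := hq.out.pos
  have hq0 : (0 : ℝ) < q := by exact_mod_cast hqpos
  have h := card_le_of_scalar (q := q) (N := N) (det_of_mem_coeImage
    (Γ := ((halfElements N).filter fun γ : SL(3, ℤ) => ∃ c : ZMod q,
      (γ : Matrix (Fin 3) (Fin 3) ℤ).map (Int.castRingHom (ZMod q)) = Matrix.scalar (Fin 3) c)))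
    (mem_coeImage fun γ hγ => (mem_halfElements.1 (mem_filter.1 hγ).1).2)
    (mem_coeImage fun γ hγ => (mem_halfElements.1 (mem_filter.1 hγ).1).1)
    (mem_coeImage fun γ hγ => (mem_filter.1 hγ).2)
  rw [coeImage, card_map] at h
  refine h.trans ?_
  have h1 := one_le_logBound hqpos
  have h2 := harmonicSum_le_logBound hqpos hN
  have h3 := natLog_le_logBound hqpos hN0 hN
  have h4 := one_le_harmonicSum N
  have h5 : (1 : ℝ) ≤ N := by exact_mod_cast hN0
  have h6 : (N : ℝ) ^ 2 / q ^ 3 ≤ N := by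
    have : (N : ℝ) ≤ q ^ 3 := by exact_mod_cast hN
    rw [div_le_iff₀ (by positivity), sq]
    gcongr
  calc 19683 + 3 * (Nat.log 2 N : ℝ) * (q * (419904 * N ^ 2 * harmonicSum N ^ 2 / q ^ 4))
      = 19683 + 3 * (Nat.log 2 N : ℝ) * (419904 * (N ^ 2 / q ^ 3) * harmonicSum N ^ 2) := by
        field_simp
    _ ≤ 19683 * (logBound q ^ 4 * N) +
        3 * logBound q * (419904 * N * logBound q ^ 2) * logBound q := by
        refine add_le_add (le_mul_of_one_le_right (by norm_num) ?_)
          (le_trans ?_ (le_mul_of_one_le_right (by positivity) h1))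
        · exact one_le_mul_of_one_le_of_one_le (one_le_pow₀ h1) h5
        · gcongr
    _ = _ := by ring

theorem sum_boundedElements_le_logBound {N : ℕ} (hN : N ≤ q ^ 3) :
    ((∑ γ ∈ (boundedElements_finite N).toFinset, fixedFlagCount q γ : ℕ) : ℝ) ≤
      470817360 * logBound q ^ 4 * q ^ 3 * N := by
  classical
  rcases Nat.eq_zero_or_pos N with rfl | hN0
  · rw [sum_eq_zero]
    · simp
    · intro γ hγ
      have h0 : maxEntry γ * maxEntry (γ : Matrix (Fin 3) (Fin 3) ℤ).adjugate ≤ 0 := by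
        rw [Set.Finite.mem_toFinset] at hγ
        exact hγ
      have h1 := maxEntry_pos γ.det_coe
      have h2 := maxEntry_pos (det_adjugate_eq_one γ.det_coe)
      have := Nat.mul_pos h1 h2
      omega
  have hle : ((∑ γ ∈ (boundedElements_finite N).toFinset, fixedFlagCount q γ : ℕ) : ℝ) ≤
      2 * (36 * #(halfElements N) +
    72 * q * #((halfElements N).filter fun γ : SL(3, ℤ) => OffDiagProportional q γ) +
    4 * q ^ 3 * #((halfElements N).filter fun γ : SL(3, ℤ) => ∃ c : ZMod q,
      (γ : Matrix (Fin 3) (Fin 3) ℤ).map (Int.castRingHom (ZMod q)) = Matrix.scalar (Fin 3) c)) := by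
    exact_mod_cast (sum_boundedElements_le N).trans
      (Nat.mul_le_mul_left 2 (sum_halfElements_le N))
  refine hle.trans ?_
  have hq0 : (0 : ℝ) < q := by exact_mod_cast hq.out.pos
  have h1 := one_le_logBound hq.out.pos
  have hA : (#(halfElements N) : ℝ) ≤ 1279395 * logBound q ^ 4 * (N * q ^ 3) := by
    refine (card_halfElements_le hN0 hN).trans ?_
    have : (N : ℝ) ≤ q ^ 3 := by exact_mod_cast hN
    rw [sq (N : ℝ)]
    gcongr
  -- The weights add up to 2(36 + 144 + 4) = 368, and 470817360 = 368·1279395.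
  calc _ ≤ 2 * (36 * (1279395 * logBound q ^ 4 * (N * q ^ 3)) +
        72 * q * (2 * (1279395 * logBound q ^ 4 * (N * q ^ 2))) +
        4 * q ^ 3 * (1279395 * logBound q ^ 4 * N)) := by
        gcongr
        exacts [card_proportional_le hN0 hN, card_scalar_le hN0 hN]
    _ = _ := by ring

end Assembly

/-! ### The main theorem -/

theorem theorem5p2 :
    ∃ C : ℝ, 0 < C ∧ ∀ ε : ℝ, 0 < ε → ∃ K : ℝ, 0 < K ∧
      ∀ (q : ℕ) [Fact q.Prime] (T : ℝ), 0 ≤ T → T ≤ C * (q : ℝ) ^ 3 →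
        (fixedFlagPairs q T).Finite ∧
          ((fixedFlagPairs q T).ncard : ℝ) ≤ K * (q : ℝ) ^ (3 + ε) * T := by
  -- C = 1 serves only to give ⌊T⌋ ≤ q^3.
  refine ⟨1, one_pos, fun ε hε => ⟨470817360 * (2 + 24 / ε) ^ 4, by positivity, ?_⟩⟩
  intro q hq T hT hTq
  refine ⟨finite_fixedFlagPairs hT, ?_⟩
  have hq0 : (0 : ℝ) < q := by exact_mod_cast hq.out.pos
  have hN : ⌊T⌋₊ ≤ q ^ 3 := by
    refine Nat.floor_le_of_le ?_
    push_cast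
    linarith
  calc ((fixedFlagPairs q T).ncard : ℝ)
      ≤ ((∑ γ ∈ (boundedElements_finite ⌊T⌋₊).toFinset, fixedFlagCount q γ : ℕ) : ℝ) := by
        exact_mod_cast ncard_fixedFlagPairs_le hT
    _ ≤ 470817360 * logBound q ^ 4 * q ^ 3 * ⌊T⌋₊ := sum_boundedElements_le_logBound hN
    _ ≤ 470817360 * ((2 + 24 / ε) ^ 4 * (q : ℝ) ^ ε) * q ^ 3 * T := by
        gcongr
        exacts [logBound_pow_le hε hq.out.pos, Nat.floor_le hT]
    _ = 470817360 * (2 + 24 / ε) ^ 4 * (q : ℝ) ^ (3 + ε) * T := by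
        rw [Real.rpow_add hq0, Real.rpow_ofNat]
        ring
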